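/- Let $(M,\Lambda)$ be a Poisson manifold, i.e. a smooth manifold $M$ of finite dimension with a smooth 2-vector $\Lambda$ whose Schouten–Nijenhuis bracket satisfies $[\Lambda,\Lambda]=0$. Let $\Omega^k(M)$ be the space of smooth $k$-forms on $M$ ($\Omega^k(M)=0$ for $k<0$), and let $i(\Lambda):\Omega^k(M)\to\Omega^{k-2}(M)$ be the contraction by $\Lambda$, normalized so that $i(X\wedge Y)\alpha=\alpha(X,Y,\cdot,\dots,\cdot)$. For $\alpha\in\Omega^k(M)$ and $\beta\in\Omega^{k-1}(M)$ put $$\bar\delta\alpha=i(\Lambda)\,d\alpha-d\,i(\Lambda)\alpha\in\Omega^{k-1}(M),\qquad \delta(\alpha,\beta)=\bigl(\bar\delta\alpha,\ \bar\delta\beta+(-1)^k i(\Lambda)\alpha\bigr)\in\Omega^{k-1}(M)\oplus\Omega^{k-2}(M).$$ Then $\bar\delta^2=0$ and $\delta^2=0$. Write $H^{can}_k(M)$ for the homology of $(\Omega^*(M),\bar\delta)$ in degree $k$ (the canonical homology) and $H^{LJ}_k(M)$ for the homology of $(\Omega^*(M)\oplus\Omega^{*-1}(M),\delta)$ in degree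 $k$ (the Lichnerowicz–Jacobi homology). Let $(0,Id_k):\Omega^{k-1}(M)\to\Omega^k(M)\oplus\Omega^{k-1}(M)$, $\beta\mapsto(0,\beta)$, and $(\pi_1)_k:\Omega^k(M)\oplus\Omega^{k-1}(M)\to\Omega^k(M)$, $(\alpha,\beta)\mapsto\alpha$, which are homomorphisms of $C^\infty(M,\mathbb R)$-modules. Then: 1. The mappings $(0,Id_k)$ and $(\pi_1)_k$ define an exact sequence of complexes $$0\longrightarrow(\Omega^{*-1}(M),\bar\delta)\xrightarrow{(0,Id)}(\Omega^*(M)\oplus\Omega^{*-1}(M),\delta)\xrightarrow{\ \pi_1\ }(\Omega^*(M),\bar\delta)\longrightarrow0.$$ 2. This exact sequence induces a long exact homology sequence $$\cdots\longrightarrow H^{can}_{k-1}(M)\xrightarrow{((0,Id_k))_*}H^{LJ}_k(M)\xrightarrow{((\pi_1)_k)_*}H^{can}_k(M)\xrightarrow{\ \Lambda_k\ }H^{can}_{k-2}(M)\longrightarrow\cdots$$ whose connecting homomorphism $\Lambda_k$ is given by $\Lambda_k[\alpha]=(-1)^k[i(\Lambda)\alpha]$ for all $[\alpha]\in H^{can}_k(M)$.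 -/

import Mathlib

open scoped Manifold ContDiff Topology

noncomputable section

namespace PoissonHomology

/-! ### Form fields and bivector fields on an `n`-dimensional manifold -/

/-- The model space `ℝⁿ`. -/
abbrev Eu (n : ℕ) : Type := EuclideanSpace ℝ (Fin n)

section Fields

variable {n : ℕ} {M : Type*} [TopologicalSpace M] [ChartedSpace (Eu n) M]

variable (n M) in
/-- A (not necessarily smooth) field of alternating `k`-linear forms on the tangent spaces. -/
abbrev FormField (k : ℕ) : Type _ := ∀ x : M, TangentSpace (𝓡 n) x [⋀^Fin k]→L[ℝ] ℝ

variable (n M) in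
/-- A (not necessarily smooth) field of 2-vectors: an element of `Λ²(T_x M)` is regarded as an
alternating bilinear form `(a, b) ↦ Λ_x(a, b)` on the cotangent space `T_x^* M`. -/
abbrev BivectorField : Type _ := ∀ x : M, (TangentSpace (𝓡 n) x →L[ℝ] ℝ) [⋀^Fin 2]→ₗ[ℝ] ℝ

/-- The pull-back `f^* α` of a form field on `M` along a map `f : ℝⁿ → M`. For `f = e.symm` with
`e` a chart, this is the expression of `α` in the chart. -/
def pullForm {k : ℕ} (f : Eu n → M) (α : FormField n M k) (y : Eu n) : Eu n [⋀^Fin k]→L[ℝ] ℝ :=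
  (α (f y)).compContinuousLinearMap (mfderiv (𝓡 n) (𝓡 n) f y)

/-- The component `Λ^{ij} = Λ(de^i, de^j)` of a bivector field in a chart `e`, as a function of the
coordinates `y ∈ e.target`. -/
def coeff (e : OpenPartialHomeomorph M (Eu n)) (Λ : BivectorField n M) (i j : Fin n) (y : Eu n) : ℝ :=
  Λ (e.symm y) ![(EuclideanSpace.proj i : Eu n →L[ℝ] ℝ) ∘L mfderiv (𝓡 n) (𝓡 n) e (e.symm y),
    (EuclideanSpace.proj j : Eu n →L[ℝ] ℝ) ∘L mfderiv (𝓡 n) (𝓡 n) e (e.symm y)]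

/-- A form field is smooth if its expression in each chart is. -/
def SmoothForm {k : ℕ} (α : FormField n M k) : Prop :=
  ∀ p : M, ContDiffOn ℝ ∞ (pullForm (chartAt (Eu n) p).symm α) (chartAt (Eu n) p).target

/-- A bivector field is smooth if its components in each chart are. -/
def SmoothBivector (Λ : BivectorField n M) : Prop :=
  ∀ (p : M) (i j : Fin n),
    ContDiffOn ℝ ∞ (coeff (chartAt (Eu n) p) Λ i j) (chartAt (Eu n) p).target

/-- The exterior derivative: at `x`, take the exterior derivative on `ℝⁿ` of the expression in the
chart at `x`, and pull it back to `T_x M` by the differential of that chart. -/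
def extDerivField {k : ℕ} (α : FormField n M k) : FormField n M (k + 1) := fun x =>
  (extDeriv (pullForm (chartAt (Eu n) x).symm α) (chartAt (Eu n) x x)).compContinuousLinearMap
    (mfderiv (𝓡 n) (𝓡 n) (chartAt (Eu n) x) x)

/-- Contraction of a `(k+2)`-form by a 2-vector `P`, on a copy of `ℝⁿ`:
`½ ∑_{i,j} P(e^i, e^j) α(e_i, e_j, ⬝, …, ⬝)`. Thus `i(X ∧ Y)α = α(X, Y, ⬝, …, ⬝)`, and
`i(P)(a ∧ b) = P(a, b)` for 1-forms `a`, `b`. -/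
def contr {k : ℕ} (P : (Eu n →L[ℝ] ℝ) [⋀^Fin 2]→ₗ[ℝ] ℝ) (α : Eu n [⋀^Fin (k + 2)]→L[ℝ] ℝ) :
    Eu n [⋀^Fin k]→L[ℝ] ℝ :=
  (1 / 2 : ℝ) • ∑ i, ∑ j, P ![EuclideanSpace.proj i, EuclideanSpace.proj j] •
    (α.curryLeft (EuclideanSpace.single i 1)).curryLeft (EuclideanSpace.single j 1)

/-- The pointwise contraction `i(Λ)α` of a form field by a bivector field; each `T_x M` is by
definition a copy of `ℝⁿ`, and `contr` does not depend on the choice of a basis of it. -/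
def contrField {k : ℕ} (Λ : BivectorField n M) (α : FormField n M (k + 2)) : FormField n M k :=
  fun x => contr (Λ x) (α x)

/-- The components of the Schouten–Nijenhuis bracket of two bivector fields
`P = ½ ∑ P^{ij} ∂_i ∧ ∂_j` and `Q` on an open subset of `ℝⁿ`:
`[P, Q]^{ijk} = ∑_l ∑_{cyclic (i,j,k)} (P^{kl} ∂_l Q^{ij} + Q^{kl} ∂_l P^{ij})`. -/
def schouten (P Q : Fin n → Fin n → Eu n → ℝ) (i j k : Fin n) (y : Eu n) : ℝ :=
  ∑ l : Fin n,
    ((P k l y * fderiv ℝ (Q i j) y (EuclideanSpace.single l 1) +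
        Q k l y * fderiv ℝ (P i j) y (EuclideanSpace.single l 1)) +
      (P i l y * fderiv ℝ (Q j k) y (EuclideanSpace.single l 1) +
        Q i l y * fderiv ℝ (P j k) y (EuclideanSpace.single l 1)) +
      (P j l y * fderiv ℝ (Q k i) y (EuclideanSpace.single l 1) +
        Q j l y * fderiv ℝ (P k i) y (EuclideanSpace.single l 1)))

/-! ### Exterior derivative and contraction preserve smoothness -/

theorem pullForm_congr {k : ℕ} {f g : Eu n → M} (α : FormField n M k) {y : Eu n}
    (h : f =ᶠ[𝓝 y] g) : pullForm f α y = pullForm g α y := by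
  have h1 : f y = g y := h.eq_of_nhds
  have h2 : (mfderiv (𝓡 n) (𝓡 n) f y : Eu n →L[ℝ] Eu n) = mfderiv (𝓡 n) (𝓡 n) g y := h.mfderiv_eq
  have h3 : ((α (f y) : Eu n [⋀^Fin k]→L[ℝ] ℝ)) = α (g y) := by
    have : ∀ p q : M, p = q → (α p : Eu n [⋀^Fin k]→L[ℝ] ℝ) = α q := by
      rintro p q rfl; rfl
    exact this _ _ h1
  have : ∀ (A B : Eu n [⋀^Fin k]→L[ℝ] ℝ) (a b : Eu n →L[ℝ] Eu n), A = B → a = b →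
    A.compContinuousLinearMap a = B.compContinuousLinearMap b := by
    rintro _ _ _ _ rfl rfl; rfl
  exact this _ _ _ _ h3 h2

theorem pullForm_comp {k : ℕ} {f : Eu n → M} {φ : Eu n → Eu n} (α : FormField n M k) {y : Eu n}
    (hf : MDifferentiableAt (𝓡 n) (𝓡 n) f (φ y)) (hφ : DifferentiableAt ℝ φ y) :
    pullForm (f ∘ φ) α y = (pullForm f α (φ y)).compContinuousLinearMap (fderiv ℝ φ y) := by
  have h := mfderiv_comp y hf hφ.mdifferentiableAt
  rw [mfderiv_eq_fderiv] at h
  unfold pullForm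
  rw [h]
  rfl


variable [IsManifold (𝓡 n) ∞ M]

theorem contDiffOn_transition (p q : M) :
    ContDiffOn ℝ ∞ (chartAt (Eu n) q ∘ (chartAt (Eu n) p).symm)
      ((chartAt (Eu n) p).target ∩ (chartAt (Eu n) p).symm ⁻¹' (chartAt (Eu n) q).source) := by
  have h := (contDiffGroupoid ∞ (𝓡 n)).compatible (chart_mem_atlas (Eu n) p)
    (chart_mem_atlas (Eu n) q)
  rw [contDiffGroupoid, mem_groupoid_of_pregroupoid] at h
  have := h.1
  simpa [contDiffPregroupoid] using this

theorem pullForm_change {k : ℕ} (α : FormField n M k) (p q : M) {y : Eu n}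
    (hy : y ∈ (chartAt (Eu n) p).target) (hq : (chartAt (Eu n) p).symm y ∈ (chartAt (Eu n) q).source) :
    pullForm (chartAt (Eu n) p).symm α y =
      (pullForm (chartAt (Eu n) q).symm α ((chartAt (Eu n) q ∘ (chartAt (Eu n) p).symm) y)).compContinuousLinearMap
        (fderiv ℝ (chartAt (Eu n) q ∘ (chartAt (Eu n) p).symm) y) := by
  have ho : IsOpen ((chartAt (Eu n) p).target ∩ (chartAt (Eu n) p).symm ⁻¹' (chartAt (Eu n) q).source) :=
    (chartAt (Eu n) p).isOpen_inter_preimage_symm (chartAt (Eu n) q).open_source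
  have hmem := ho.mem_nhds ⟨hy, hq⟩
  rw [← pullForm_comp]
  · apply pullForm_congr
    filter_upwards [hmem] with z hz
    exact ((chartAt (Eu n) q).left_inv hz.2).symm
  · exact (mdifferentiable_chart (I := 𝓡 n) q).mdifferentiableAt_symm ((chartAt (Eu n) q).map_source hq)
  · exact ((contDiffOn_transition p q).contDiffAt hmem).differentiableAt (by simp)

theorem pullForm_extDerivField {k : ℕ} {α : FormField n M k} (hα : SmoothForm α) (p : M) {y : Eu n}
    (hy : y ∈ (chartAt (Eu n) p).target) :
    pullForm (chartAt (Eu n) p).symm (extDerivField α) y =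
      extDeriv (pullForm (chartAt (Eu n) p).symm α) y := by
  set q := (chartAt (Eu n) p).symm y with hq
  have hqs : q ∈ (chartAt (Eu n) q).source := mem_chart_source _ _
  have ho : IsOpen ((chartAt (Eu n) p).target ∩ (chartAt (Eu n) p).symm ⁻¹' (chartAt (Eu n) q).source) :=
    (chartAt (Eu n) p).isOpen_inter_preimage_symm (chartAt (Eu n) q).open_source
  have hmem := ho.mem_nhds ⟨hy, hqs⟩
  have h1 : pullForm (chartAt (Eu n) p).symm α =ᶠ[𝓝 y] fun z =>
      (pullForm (chartAt (Eu n) q).symm α ((chartAt (Eu n) q ∘ (chartAt (Eu n) p).symm) z)).compContinuousLinearMap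
        (fderiv ℝ (chartAt (Eu n) q ∘ (chartAt (Eu n) p).symm) z) := by
    filter_upwards [hmem] with z hz
    exact pullForm_change α p q hz.1 hz.2
  have hd : DifferentiableAt ℝ (pullForm (chartAt (Eu n) q).symm α)
      ((chartAt (Eu n) q ∘ (chartAt (Eu n) p).symm) y) :=
    ((hα q).contDiffAt ((chartAt (Eu n) q).open_target.mem_nhds
      ((chartAt (Eu n) q).map_source hqs))).differentiableAt (by simp)
  have hinf : minSmoothness ℝ 2 ≤ (∞ : WithTop ℕ∞) := by
    rw [minSmoothness_of_isRCLikeNormedField]; exact WithTop.coe_le_coe.2 le_top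
  rw [h1.extDeriv_eq, extDeriv_pullback hd ((contDiffOn_transition p q).contDiffAt hmem) hinf]
  have h2 : fderiv ℝ (chartAt (Eu n) q ∘ (chartAt (Eu n) p).symm) y =
      ContinuousLinearMap.comp (mfderiv (𝓡 n) (𝓡 n) (chartAt (Eu n) q) q : Eu n →L[ℝ] Eu n)
        (mfderiv (𝓡 n) (𝓡 n) (chartAt (Eu n) p).symm y : Eu n →L[ℝ] Eu n) := by
    rw [← mfderiv_eq_fderiv]
    exact mfderiv_comp y ((mdifferentiable_chart (I := 𝓡 n) q).mdifferentiableAt hqs)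
      ((mdifferentiable_chart (I := 𝓡 n) p).mdifferentiableAt_symm hy)
  rw [h2]
  rfl

theorem SmoothForm.extDerivField {k : ℕ} {α : FormField n M k} (hα : SmoothForm α) :
    SmoothForm (extDerivField α) := by
  intro p
  have h1 : ContDiffOn ℝ ∞ (extDeriv (pullForm (chartAt (Eu n) p).symm α)) (chartAt (Eu n) p).target := by
    have := (hα p).fderiv_of_isOpen (m := ∞) (chartAt (Eu n) p).open_target (by simp)
    exact (ContinuousAlternatingMap.alternatizeUncurryFinCLM ℝ (Eu n) ℝ).contDiff.comp_contDiffOn this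
  exact h1.congr fun y hy => pullForm_extDerivField hα p hy

theorem sum_dual (A B : Eu n →L[ℝ] Eu n) (hAB : ∀ v, A (B v) = v)
    (T : (Eu n →L[ℝ] ℝ) → Eu n → ℝ) (h1 : ∀ x, IsLinearMap ℝ fun X => T X x)
    (h2 : ∀ X, IsLinearMap ℝ (T X)) :
    ∑ i : Fin n, T ((EuclideanSpace.proj i : Eu n →L[ℝ] ℝ) ∘L B) (A (EuclideanSpace.single i 1)) =
      ∑ i : Fin n, T (EuclideanSpace.proj i) (EuclideanSpace.single i 1) := by
  have hB : ∀ i : Fin n, (EuclideanSpace.proj i : Eu n →L[ℝ] ℝ) ∘L B =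
      ∑ a : Fin n, (B (EuclideanSpace.single a 1)) i • (EuclideanSpace.proj a : Eu n →L[ℝ] ℝ) := by
    intro i
    ext v
    have hv : v = ∑ a : Fin n, v a • (EuclideanSpace.single a 1 : Eu n) := by
      simpa using ((EuclideanSpace.basisFun (Fin n) ℝ).sum_repr v).symm
    conv_lhs => rw [hv]
    simp [mul_comm]
  have hv : ∀ v : Eu n, ∑ i : Fin n, v i • (EuclideanSpace.single i 1 : Eu n) = v := by
    intro v
    simpa using ((EuclideanSpace.basisFun (Fin n) ℝ).sum_repr v)
  have e1 : ∀ i : Fin n, T ((EuclideanSpace.proj i : Eu n →L[ℝ] ℝ) ∘L B)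
      (A (EuclideanSpace.single i 1)) = ∑ a : Fin n, T (EuclideanSpace.proj a)
        ((B (EuclideanSpace.single a 1)) i • A (EuclideanSpace.single i 1)) := by
    intro i
    rw [hB]
    have := map_sum (h1 (A (EuclideanSpace.single i 1))).mk'
      (fun a : Fin n => (B (EuclideanSpace.single a 1)) i • (EuclideanSpace.proj a : Eu n →L[ℝ] ℝ))
      Finset.univ
    simp only [IsLinearMap.mk'_apply] at this
    rw [this]
    refine Finset.sum_congr rfl fun a _ => ?_
    rw [(h1 _).map_smul, (h2 _).map_smul]
  rw [Finset.sum_congr rfl fun i _ => e1 i, Finset.sum_comm]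
  refine Finset.sum_congr rfl fun a _ => ?_
  have := map_sum (h2 (EuclideanSpace.proj a)).mk'
    (fun i : Fin n => (B (EuclideanSpace.single a 1)) i • A (EuclideanSpace.single i 1)) Finset.univ
  simp only [IsLinearMap.mk'_apply] at this
  rw [← this]
  congr 1
  simp_rw [← map_smul, ← map_sum]
  rw [hv, hAB]

theorem contr_apply {k : ℕ} (P : (Eu n →L[ℝ] ℝ) [⋀^Fin 2]→ₗ[ℝ] ℝ)
    (α : Eu n [⋀^Fin (k + 2)]→L[ℝ] ℝ) (v : Fin k → Eu n) :
    contr P α v = (1 / 2 : ℝ) * ∑ i, ∑ j, P ![EuclideanSpace.proj i, EuclideanSpace.proj j] *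
      α (Matrix.vecCons (EuclideanSpace.single i 1) (Matrix.vecCons (EuclideanSpace.single j 1) v)) := by
  simp [contr, ContinuousAlternatingMap.sum_apply]

theorem contr_add {k : ℕ} (P : (Eu n →L[ℝ] ℝ) [⋀^Fin 2]→ₗ[ℝ] ℝ)
    (α β : Eu n [⋀^Fin (k + 2)]→L[ℝ] ℝ) : contr P (α + β) = contr P α + contr P β := by
  ext v
  simp only [contr_apply, ContinuousAlternatingMap.add_apply, mul_add, Finset.sum_add_distrib]

theorem contr_smul {k : ℕ} (P : (Eu n →L[ℝ] ℝ) [⋀^Fin 2]→ₗ[ℝ] ℝ) (c : ℝ)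
    (α : Eu n [⋀^Fin (k + 2)]→L[ℝ] ℝ) : contr P (c • α) = c • contr P α := by
  ext v
  simp only [contr_apply, ContinuousAlternatingMap.smul_apply, smul_eq_mul, Finset.mul_sum]
  exact Finset.sum_congr rfl fun i _ => Finset.sum_congr rfl fun j _ => by ring

theorem contr_comp {k : ℕ} (P : (Eu n →L[ℝ] ℝ) [⋀^Fin 2]→ₗ[ℝ] ℝ)
    (α : Eu n [⋀^Fin (k + 2)]→L[ℝ] ℝ) (A B : Eu n →L[ℝ] Eu n) (hAB : ∀ v, A (B v) = v) :
    (contr P α).compContinuousLinearMap A = (1 / 2 : ℝ) • ∑ i, ∑ j,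
      P ![(EuclideanSpace.proj i : Eu n →L[ℝ] ℝ) ∘L B, (EuclideanSpace.proj j : Eu n →L[ℝ] ℝ) ∘L B] •
      ((α.compContinuousLinearMap A).curryLeft (EuclideanSpace.single i 1)).curryLeft
        (EuclideanSpace.single j 1) := by
  ext v
  have hP1 : ∀ Y, IsLinearMap ℝ fun X => P ![X, Y] := fun Y =>
    ⟨fun X X' => congrArg (fun f => f ![Y]) (map_add P.curryLeft X X'),
     fun c X => congrArg (fun f => f ![Y]) (map_smul P.curryLeft c X)⟩
  have hP2 : ∀ X, IsLinearMap ℝ fun Y => P ![X, Y] := fun X =>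
    ⟨fun Y Y' => congrArg (fun f => f ![]) (map_add (P.curryLeft X).curryLeft Y Y'),
     fun c Y => congrArg (fun f => f ![]) (map_smul (P.curryLeft X).curryLeft c Y)⟩
  have ha1 : ∀ y w, IsLinearMap ℝ fun x => α (Matrix.vecCons x (Matrix.vecCons y w)) := fun y w =>
    ⟨fun X X' => congrArg (fun f => f (Matrix.vecCons y w)) (map_add α.curryLeft X X'),
     fun c X => congrArg (fun f => f (Matrix.vecCons y w)) (map_smul α.curryLeft c X)⟩
  have ha2 : ∀ x w, IsLinearMap ℝ fun y => α (Matrix.vecCons x (Matrix.vecCons y w)) := fun x w =>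
    ⟨fun X X' => congrArg (fun f => f w) (map_add (α.curryLeft x).curryLeft X X'),
     fun c X => congrArg (fun f => f w) (map_smul (α.curryLeft x).curryLeft c X)⟩
  have hl : ((contr P α).compContinuousLinearMap A) v = contr P α (fun i => A (v i)) := rfl
  rw [hl, contr_apply]
  simp only [ContinuousAlternatingMap.smul_apply, ContinuousAlternatingMap.sum_apply, smul_eq_mul,
    ContinuousAlternatingMap.curryLeft_apply_apply]
  congr 1
  have hr : ∀ i j : Fin n, (α.compContinuousLinearMap A) (Matrix.vecCons (EuclideanSpace.single i 1)
      (Matrix.vecCons (EuclideanSpace.single j 1) v)) =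
      α (Matrix.vecCons (A (EuclideanSpace.single i 1)) (Matrix.vecCons (A (EuclideanSpace.single j 1))
        fun i => A (v i))) := by
    intro i j
    simp only [ContinuousAlternatingMap.compContinuousLinearMap_apply]
    congr 1
    funext l
    refine Fin.cases rfl (fun l => ?_) l
    refine Fin.cases rfl (fun l => rfl) l
  simp_rw [hr]
  symm
  have step : ∀ (X : Eu n →L[ℝ] ℝ) (x : Eu n), ∑ j : Fin n,
      P ![X, (EuclideanSpace.proj j : Eu n →L[ℝ] ℝ) ∘L B] *
        α (Matrix.vecCons x (Matrix.vecCons (A (EuclideanSpace.single j 1)) fun i => A (v i))) =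
      ∑ j : Fin n, P ![X, EuclideanSpace.proj j] *
        α (Matrix.vecCons x (Matrix.vecCons (EuclideanSpace.single j 1) fun i => A (v i))) := by
    intro X x
    refine sum_dual A B hAB (fun Y y => P ![X, Y] * α (Matrix.vecCons x (Matrix.vecCons y fun i => A (v i))))
      (fun y => ⟨fun a b => ?_, fun c a => ?_⟩) (fun Y => ⟨fun a b => ?_, fun c a => ?_⟩)
    · rw [(hP2 X).map_add, add_mul]
    · rw [(hP2 X).map_smul, smul_mul_assoc]
    · rw [(ha2 x _).map_add, mul_add]
    · rw [(ha2 x _).map_smul, mul_smul_comm]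
  simp_rw [step]
  refine sum_dual A B hAB (fun X x => ∑ j : Fin n, P ![X, EuclideanSpace.proj j] *
        α (Matrix.vecCons x (Matrix.vecCons (EuclideanSpace.single j 1) fun i => A (v i))))
      (fun y => ⟨fun a b => ?_, fun c a => ?_⟩) (fun Y => ⟨fun a b => ?_, fun c a => ?_⟩)
  · rw [← Finset.sum_add_distrib]
    exact Finset.sum_congr rfl fun j _ => by rw [(hP1 _).map_add, add_mul]
  · rw [Finset.smul_sum]
    exact Finset.sum_congr rfl fun j _ => by rw [(hP1 _).map_smul, smul_mul_assoc]
  · rw [← Finset.sum_add_distrib]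
    exact Finset.sum_congr rfl fun j _ => by rw [(ha1 _ _).map_add, mul_add]
  · rw [Finset.smul_sum]
    exact Finset.sum_congr rfl fun j _ => by rw [(ha1 _ _).map_smul, mul_smul_comm]

theorem pullForm_contrField {k : ℕ} (Λ : BivectorField n M) (α : FormField n M (k + 2)) (p : M) {y : Eu n}
    (hy : y ∈ (chartAt (Eu n) p).target) :
    pullForm (chartAt (Eu n) p).symm (contrField Λ α) y = (1 / 2 : ℝ) • ∑ i, ∑ j,
      coeff (chartAt (Eu n) p) Λ i j y •
      ((pullForm (chartAt (Eu n) p).symm α y).curryLeft (EuclideanSpace.single i 1)).curryLeft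
        (EuclideanSpace.single j 1) := by
  have h := (mdifferentiable_chart (I := 𝓡 n) p).symm_comp_deriv ((chartAt (Eu n) p).map_target hy)
  rw [(chartAt (Eu n) p).right_inv hy] at h
  exact contr_comp (Λ ((chartAt (Eu n) p).symm y)) (α ((chartAt (Eu n) p).symm y))
    (mfderiv (𝓡 n) (𝓡 n) (chartAt (Eu n) p).symm y)
    (mfderiv (𝓡 n) (𝓡 n) (chartAt (Eu n) p) ((chartAt (Eu n) p).symm y))
    (fun v => congrArg (fun f : Eu n →L[ℝ] Eu n => f v) h)

theorem SmoothForm.contrField {k : ℕ} {Λ : BivectorField n M} {α : FormField n M (k + 2)}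
    (hΛ : SmoothBivector Λ)
    (hα : SmoothForm α) : SmoothForm (contrField Λ α) := by
  intro p
  refine ContDiffOn.congr ?_ fun y hy => pullForm_contrField Λ α p hy
  refine ContDiffOn.const_smul (1 / 2 : ℝ) ?_
  refine ContDiffOn.sum fun i _ => ContDiffOn.sum fun j _ => ?_
  refine ContDiffOn.smul (hΛ p i j) ?_
  have h1 : ContDiff ℝ ∞ fun β : Eu n [⋀^Fin (k + 2)]→L[ℝ] ℝ => β.curryLeft (EuclideanSpace.single i 1) :=
    (ContinuousAlternatingMap.curryLeftLI (𝕜 := ℝ) (E := Eu n) (F := ℝ) (n := k + 1)).contDiff.clm_apply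
      contDiff_const
  have h2 : ContDiff ℝ ∞ fun β : Eu n [⋀^Fin (k + 1)]→L[ℝ] ℝ => β.curryLeft (EuclideanSpace.single j 1) :=
    (ContinuousAlternatingMap.curryLeftLI (𝕜 := ℝ) (E := Eu n) (F := ℝ) (n := k)).contDiff.clm_apply
      contDiff_const
  exact (h2.comp h1).comp_contDiffOn (hα p)

end Fields

/-! ### Differential forms, bivectors, Poisson structures -/

/-- `Ω^k(M)`: smooth differential `k`-forms on the `n`-dimensional manifold `M`. -/
@[ext]
structure DiffForm (n : ℕ) (M : Type*) [TopologicalSpace M] [ChartedSpace (Eu n) M] (k : ℕ) where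
  /-- the underlying field of alternating forms -/
  toFun : FormField n M k
  smooth : SmoothForm toFun

/-- Smooth 2-vectors on the `n`-dimensional manifold `M`. -/
structure Bivector (n : ℕ) (M : Type*) [TopologicalSpace M] [ChartedSpace (Eu n) M] where
  /-- the underlying field of 2-vectors -/
  toFun : BivectorField n M
  smooth : SmoothBivector toFun

section Forms

variable {n : ℕ} {M : Type*} [TopologicalSpace M] [ChartedSpace (Eu n) M]

/-- `Λ` is a Poisson structure: `[Λ, Λ] = 0`, i.e. all components of the Schouten–Nijenhuis bracket
vanish in each chart. -/
def Bivector.IsPoisson (Λ : Bivector n M) : Prop :=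
  ∀ p : M, ∀ y ∈ (chartAt (Eu n) p).target, ∀ i j k : Fin n,
    schouten (coeff (chartAt (Eu n) p) Λ.toFun) (coeff (chartAt (Eu n) p) Λ.toFun) i j k y = 0

namespace DiffForm

variable {k : ℕ}

theorem toFun_injective : Function.Injective (toFun : DiffForm n M k → FormField n M k) :=
  fun _ _ h => DiffForm.ext h

instance : Zero (DiffForm n M k) := ⟨⟨0, fun _ => contDiffOn_const (c := 0)⟩⟩

instance : Add (DiffForm n M k) :=
  ⟨fun α β => ⟨α.toFun + β.toFun, fun p => (α.smooth p).add (β.smooth p)⟩⟩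

instance : Neg (DiffForm n M k) := ⟨fun α => ⟨-α.toFun, fun p => (α.smooth p).neg⟩⟩

instance : Sub (DiffForm n M k) :=
  ⟨fun α β => ⟨α.toFun - β.toFun, fun p => (α.smooth p).sub (β.smooth p)⟩⟩

instance : SMul ℝ (DiffForm n M k) :=
  ⟨fun c α => ⟨c • α.toFun, fun p => (α.smooth p).const_smul c⟩⟩

instance : SMul ℕ (DiffForm n M k) :=
  ⟨fun c α => ⟨c • α.toFun, fun p => (α.smooth p).const_smul c⟩⟩

instance : SMul ℤ (DiffForm n M k) :=
  ⟨fun c α => ⟨c • α.toFun, fun p => (α.smooth p).const_smul c⟩⟩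

instance : AddCommGroup (DiffForm n M k) :=
  toFun_injective.addCommGroup toFun rfl (fun _ _ => rfl) (fun _ => rfl) (fun _ _ => rfl)
    (fun _ _ => rfl) (fun _ _ => rfl)

instance : Module ℝ (DiffForm n M k) :=
  toFun_injective.module ℝ ⟨⟨toFun, rfl⟩, fun _ _ => rfl⟩ fun _ _ => rfl

end DiffForm

variable [IsManifold (𝓡 n) ∞ M]

/-- Multiplication of forms by smooth functions, `(f α)(x) = f(x) α(x)`. -/
instance (k : ℕ) : SMul C^∞⟮𝓡 n, M; ℝ⟯ (DiffForm n M k) :=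
  ⟨fun f α => ⟨fun x => f x • α.toFun x, fun p =>
    ((f.contMDiff.comp_contMDiffOn (contMDiffOn_chart_symm (I := 𝓡 n) (x := p))).contDiffOn).smul
      (α.smooth p)⟩⟩

/-- `Ω^k(M)` as a module over `C^∞(M, ℝ)`. -/
instance (k : ℕ) : Module C^∞⟮𝓡 n, M; ℝ⟯ (DiffForm n M k) where
  one_smul α := DiffForm.ext (funext fun x => one_smul ℝ (α.toFun x))
  mul_smul f g α := DiffForm.ext (funext fun x => mul_smul (f x) (g x) (α.toFun x))
  smul_zero f := DiffForm.ext (funext fun x => smul_zero (f x))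
  smul_add f α β := DiffForm.ext (funext fun x => smul_add (f x) (α.toFun x) (β.toFun x))
  add_smul f g α := DiffForm.ext (funext fun x => add_smul (f x) (g x) (α.toFun x))
  zero_smul α := DiffForm.ext (funext fun x => zero_smul ℝ (α.toFun x))

/-- The exterior derivative `d : Ω^k(M) → Ω^{k+1}(M)`. -/
def extD (k : ℕ) : DiffForm n M k →ₗ[ℝ] DiffForm n M (k + 1) where
  toFun α := ⟨extDerivField α.toFun, α.smooth.extDerivField⟩
  map_add' α β := by
    refine DiffForm.ext (funext fun x => ?_)
    have h : ∀ γ : DiffForm n M k, DifferentiableAt ℝ (pullForm (chartAt (Eu n) x).symm γ.toFun)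
        (chartAt (Eu n) x x) := fun γ =>
      ((γ.smooth x).contDiffAt ((chartAt (Eu n) x).open_target.mem_nhds
        (mem_chart_target _ x))).differentiableAt (by simp)
    exact congrArg (fun A : Eu n [⋀^Fin (k + 1)]→L[ℝ] ℝ => A.compContinuousLinearMap
      (mfderiv (𝓡 n) (𝓡 n) (chartAt (Eu n) x) x : Eu n →L[ℝ] Eu n)) (extDeriv_add (h α) (h β))
  map_smul' c α := by
    refine DiffForm.ext (funext fun x => ?_)
    exact congrArg (fun A : Eu n [⋀^Fin (k + 1)]→L[ℝ] ℝ => A.compContinuousLinearMap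
      (mfderiv (𝓡 n) (𝓡 n) (chartAt (Eu n) x) x : Eu n →L[ℝ] Eu n))
      (extDeriv_smul c (pullForm (chartAt (Eu n) x).symm α.toFun))

/-- The contraction `i(Λ) : Ω^{k+2}(M) → Ω^k(M)`. -/
def contraction (Λ : Bivector n M) (k : ℕ) : DiffForm n M (k + 2) →ₗ[ℝ] DiffForm n M k where
  toFun α := ⟨contrField Λ.toFun α.toFun, SmoothForm.contrField Λ.smooth α.smooth⟩
  map_add' α β := DiffForm.ext (funext fun x => contr_add (Λ.toFun x) (α.toFun x) (β.toFun x))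
  map_smul' c α := DiffForm.ext (funext fun x => contr_smul (Λ.toFun x) c (α.toFun x))

/-! ### The graded space of forms, with degrees in `ℤ` -/

variable (n M) in
/-- The space `Ω^*(M)` of all (inhomogeneous) forms. The product over all degrees is also the sum,
as `Ω^k(M) = 0` for `k > n`. -/
abbrev Forms : Type _ := ∀ k : ℕ, DiffForm n M k

variable (n M) in
/-- `Ω^k(M)` inside `Ω^*(M)`, for `k : ℤ`; it is `0` for `k < 0`. -/
def formsOfDegree (k : ℤ) : Submodule ℝ (Forms n M) where
  carrier := {α | ∀ j : ℕ, (j : ℤ) ≠ k → α j = 0}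
  zero_mem' _ _ := rfl
  add_mem' hα hβ j hj := by simp [hα j hj, hβ j hj]
  smul_mem' c α hα j hj := by simp [hα j hj]

/-- The exterior derivative on `Ω^*(M)`. -/
def dForms : Forms n M →ₗ[ℝ] Forms n M :=
  LinearMap.pi fun k => match k with
    | 0 => 0
    | k + 1 => extD k ∘ₗ LinearMap.proj k

/-- The contraction `i(Λ)` on `Ω^*(M)`; it is zero on `Ω^0(M)` and on `Ω^1(M)`. -/
def iForms (Λ : Bivector n M) : Forms n M →ₗ[ℝ] Forms n M :=
  LinearMap.pi fun k => contraction Λ k ∘ₗ LinearMap.proj (k + 2)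

/-- The degree involution, equal to `(-1)^k` on `Ω^k(M)`. -/
def signForms : Forms n M →ₗ[ℝ] Forms n M :=
  LinearMap.pi fun k => (-1 : ℝ) ^ k • LinearMap.proj k

/-- The canonical homology operator `δ̄ α = i(Λ) dα - d i(Λ) α`. -/
def canBoundary (Λ : Bivector n M) : Forms n M →ₗ[ℝ] Forms n M :=
  iForms Λ ∘ₗ dForms - dForms ∘ₗ iForms Λ

variable (n M) in
/-- `Ω^k(M) ⊕ Ω^{k-1}(M)`, for `k : ℤ`. -/
def pairsOfDegree (k : ℤ) : Submodule ℝ (Forms n M × Forms n M) :=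
  (formsOfDegree n M k).prod (formsOfDegree n M (k - 1))

/-- The Lichnerowicz–Jacobi homology operator of a Poisson manifold (`E = 0`):
`δ(α, β) = (δ̄ α, δ̄ β + (-1)^k i(Λ) α)` for `α ∈ Ω^k(M)` and `β ∈ Ω^{k-1}(M)`. -/
def ljBoundary (Λ : Bivector n M) : Forms n M × Forms n M →ₗ[ℝ] Forms n M × Forms n M :=
  (canBoundary Λ ∘ₗ LinearMap.fst ℝ _ _).prod
    (canBoundary Λ ∘ₗ LinearMap.snd ℝ _ _ + iForms Λ ∘ₗ signForms ∘ₗ LinearMap.fst ℝ _ _)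

variable (n M) in
/-- The homomorphism `(0, Id)` of `C^∞(M, ℝ)`-modules, `β ↦ (0, β)`. -/
def zeroId : Forms n M →ₗ[C^∞⟮𝓡 n, M; ℝ⟯] Forms n M × Forms n M :=
  LinearMap.inr C^∞⟮𝓡 n, M; ℝ⟯ (Forms n M) (Forms n M)

variable (n M) in
/-- The homomorphism `π₁` of `C^∞(M, ℝ)`-modules, `(α, β) ↦ α`. -/
def pr₁ : Forms n M × Forms n M →ₗ[C^∞⟮𝓡 n, M; ℝ⟯] Forms n M :=
  LinearMap.fst C^∞⟮𝓡 n, M; ℝ⟯ (Forms n M) (Forms n M)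

end Forms

/-! ### Complexes and their homology -/

section Homology

variable {T : Type*} [AddCommGroup T] [Module ℝ T] (G : ℤ → Submodule ℝ T) (D : T →ₗ[ℝ] T)

/-- `⋯ → G_{k+1} → G_k → G_{k-1} → ⋯` with the maps induced by `D` is a complex. -/
def IsComplex : Prop :=
  ∀ k : ℤ, ∀ x ∈ G k, D x ∈ G (k - 1) ∧ D (D x) = 0

/-- The `k`-cycles `ker (D : G_k → G_{k-1})`. -/
def cycles (k : ℤ) : Submodule ℝ T := G k ⊓ LinearMap.ker D

/-- The `k`-boundaries `im (D : G_{k+1} → G_k)`. -/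
def boundaries (k : ℤ) : Submodule ℝ T := (G (k + 1)).map D

/-- The `k`-th homology, cycles modulo boundaries. -/
abbrev Homology (k : ℤ) : Type _ := cycles G D k ⧸ (boundaries G D k).submoduleOf (cycles G D k)

/-- The homology class of a cycle. -/
def homologyClass (k : ℤ) : cycles G D k →ₗ[ℝ] Homology G D k :=
  ((boundaries G D k).submoduleOf (cycles G D k)).mkQ

end Homology

section Poisson

variable {n : ℕ} {M : Type*} [TopologicalSpace M] [ChartedSpace (Eu n) M] [IsManifold (𝓡 n) ∞ M]
  (Λ : Bivector n M)

/-- The `k`-cycles of the canonical complex `(Ω^*(M), δ̄)`. -/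
abbrev canCycles (k : ℤ) : Submodule ℝ (Forms n M) := cycles (formsOfDegree n M) (canBoundary Λ) k

/-- The canonical homology `H_k^{can}(M)`. -/
abbrev HCan (k : ℤ) : Type _ := Homology (formsOfDegree n M) (canBoundary Λ) k

/-- The class in `H_k^{can}(M)` of a cycle. -/
abbrev canClass (k : ℤ) : canCycles Λ k →ₗ[ℝ] HCan Λ k :=
  homologyClass (formsOfDegree n M) (canBoundary Λ) k

/-- The `k`-cycles of the Lichnerowicz–Jacobi complex `(Ω^*(M) ⊕ Ω^{*-1}(M), δ)`. -/
abbrev ljCycles (k : ℤ) : Submodule ℝ (Forms n M × Forms n M) :=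
  cycles (pairsOfDegree n M) (ljBoundary Λ) k

/-- The Lichnerowicz–Jacobi homology `H_k^{LJ}(M)`. -/
abbrev HLJ (k : ℤ) : Type _ := Homology (pairsOfDegree n M) (ljBoundary Λ) k

/-- The class in `H_k^{LJ}(M)` of a cycle. -/
abbrev ljClass (k : ℤ) : ljCycles Λ k →ₗ[ℝ] HLJ Λ k :=
  homologyClass (pairsOfDegree n M) (ljBoundary Λ) k

end Poisson

end PoissonHomology

end

open scoped Manifold ContDiff
open PoissonHomology

/-! Write `i` for `i(Λ)`, so that `δ̄ = i d - d i`. Everything rests on the identity `2 i d i = i i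
d + d i i`, which says that `i` commutes with `δ̄`. Composing the identity with `d` on either side
and using `d² = 0` gives `δ̄² = 0`. If `s` is the degree involution, then `s` anticommutes with `δ̄`
and commutes with `i`, so the cross term `δ̄ i s + i s δ̄` of `δ²` vanishes as well.

The identity is checked pointwise in a chart, where `d` alternates the derivative. Moving a
contraction past alternatization leaves a first-order commutator `K`
(`coordContr_alternatizeUncurryFin`). Differentiating `i α` gives, besides `i ∘ Dα`, a term `Q` with
the derivatives of the coefficients. Contractions commute with each other, so all terms of `2 i d i
- i i d - d i i` cancel except `2 K(Q)`. That expression pairs the sums `∑ p^{jm} ∂_m p^{ab}` with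
triple interior products invariant under rotation, so only the cyclic sum counts, which is zero by
`[Λ, Λ] = 0` (`contrCommutator_coordContrDeriv_eq_zero`).

The long exact sequence is then that of a cone: `δ` is `δ̄` on both summands plus `i s` from the
first to the second. Lifting a cycle `z` to `(z, 0)` shows that the connecting map is induced by `i
s` (`connecting_canClass_of_lift`), and exactness is checked directly on representatives. -/

open scoped Topology

noncomputable section

namespace PoissonHomology

open ContinuousAlternatingMap (alternatizeUncurryFin alternatizeUncurryFin_apply alternatizeUncurryFinCLM_apply
  alternatizeUncurryFin_smul curryLeftLI)

/-! ### Interior products and alternatization on a vector space. -/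

section PointwiseAlgebra

variable {E : Type*} [NormedAddCommGroup E] [NormedSpace ℝ E] {k : ℕ}

/-- The interior product `ι_a` with a vector `a`, as a continuous linear map. -/
def interior (a : E) (k : ℕ) : (E [⋀^Fin (k + 1)]→L[ℝ] ℝ) →L[ℝ] E [⋀^Fin k]→L[ℝ] ℝ :=
  (ContinuousLinearMap.apply ℝ (E [⋀^Fin k]→L[ℝ] ℝ) a) ∘L
    (curryLeftLI (𝕜 := ℝ) (E := E) (F := ℝ) (n := k)).toContinuousLinearMap

@[simp]
theorem interior_apply (a : E) (η : E [⋀^Fin (k + 1)]→L[ℝ] ℝ) (v : Fin k → E) :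
    interior a k η v = η (Matrix.vecCons a v) := rfl

/-- Polarization of `ι_x ι_x = 0` at `x = a + b`. -/
theorem interior_interior (a b : E) (η : E [⋀^Fin (k + 2)]→L[ℝ] ℝ) :
    interior a k (interior b (k + 1) η) = -interior b k (interior a (k + 1) η) := by
  have h := ContinuousAlternatingMap.curryLeft_same η (a + b)
  have ha := ContinuousAlternatingMap.curryLeft_same η a
  have hb := ContinuousAlternatingMap.curryLeft_same η b
  simp only [map_add, ContinuousAlternatingMap.curryLeft_add, add_apply] at h
  rw [ha, hb, zero_add, add_zero] at h
  exact eq_neg_of_add_eq_zero_left h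

/-- Cartan's formula for the alternatization `A` of `G`: `ι_a (A G) + A (ι_a ∘ G) = G a`. -/
theorem interior_alternatizeUncurryFin (a : E) (G : E →L[ℝ] E [⋀^Fin (k + 1)]→L[ℝ] ℝ) :
    interior a (k + 1) (alternatizeUncurryFin G) =
      G a - alternatizeUncurryFin (interior a k ∘L G) := by
  ext v
  simp only [interior_apply, alternatizeUncurryFin_apply,
    ContinuousAlternatingMap.sub_apply]
  -- Slot `0` holds `a` and yields `G a`. Every other term keeps `a` in front, and its index is
  -- shifted by one, which is the source of the minus sign.
  rw [Fin.sum_univ_succ]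
  simp only [Fin.val_zero, pow_zero, one_smul, Matrix.cons_val_zero, Matrix.cons_val_succ,
    Fin.val_succ, pow_succ, mul_neg, mul_one, neg_smul, Finset.sum_neg_distrib, sub_eq_add_neg]
  congr 1
  refine congrArg _ (Finset.sum_congr rfl fun i _ => congrArg _ ?_)
  refine congrArg (G (v i)) (funext fun j => ?_)
  refine Fin.cases ?_ (fun l => ?_) j
  · simp [Fin.removeNth]
  · simp [Fin.removeNth]

/-- Cartan's formula in lowest degree is separate because `ι_a` is not defined on `0`-forms; the
correction term disappears. -/
theorem interior_alternatizeUncurryFin_zero (a : E) (G : E →L[ℝ] E [⋀^Fin 0]→L[ℝ] ℝ) :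
    interior a 0 (alternatizeUncurryFin G) = G a := by
  ext v
  simp only [interior_apply, alternatizeUncurryFin_apply, Fin.sum_univ_succ, Fin.val_zero, pow_zero,
    one_smul, Matrix.cons_val_zero, Finset.univ_eq_empty, Finset.sum_empty, add_zero]
  exact congrArg (G a) (Subsingleton.elim _ _)

end PointwiseAlgebra

/-! ### Contraction with a 2-vector on `ℝⁿ` and the pointwise Jacobi identity. -/

section Contraction

variable {n k : ℕ}

/-- The `i`-th vector of the standard basis of `ℝⁿ`. -/
abbrev stdVec (i : Fin n) : Eu n := EuclideanSpace.single i 1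

/-- Contraction `½ ∑ p^{ij} ι_j ι_i` with the 2-vector with components `p` on `ℝⁿ`. -/
def coordContr (p : Fin n → Fin n → ℝ) (k : ℕ) :
    (Eu n [⋀^Fin (k + 2)]→L[ℝ] ℝ) →L[ℝ] Eu n [⋀^Fin k]→L[ℝ] ℝ :=
  (1 / 2 : ℝ) • ∑ i, ∑ j, p i j • (interior (stdVec j) k ∘L interior (stdVec i) (k + 1))

theorem coordContr_apply (p : Fin n → Fin n → ℝ) (η : Eu n [⋀^Fin (k + 2)]→L[ℝ] ℝ) :
    coordContr p k η = (1 / 2 : ℝ) • ∑ i, ∑ j, p i j •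
      interior (stdVec j) k (interior (stdVec i) (k + 1) η) := by
  simp [coordContr, sum_apply]

/-- A contraction is built from pairs of interior products, so moving `ι_a` across it costs two
signs, which cancel. -/
theorem coordContr_interior (p : Fin n → Fin n → ℝ) (a : Eu n) (η : Eu n [⋀^Fin (k + 3)]→L[ℝ] ℝ) :
    coordContr p k (interior a (k + 2) η) = interior a k (coordContr p (k + 1) η) := by
  simp only [coordContr_apply, map_smul, map_sum]
  refine congrArg _ (Finset.sum_congr rfl fun i _ => Finset.sum_congr rfl fun j _ => congrArg _ ?_)
  rw [interior_interior (stdVec i) a, map_neg, interior_interior (stdVec j) a, neg_neg]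

theorem coordContr_comm (p q : Fin n → Fin n → ℝ) (η : Eu n [⋀^Fin (k + 4)]→L[ℝ] ℝ) :
    coordContr p k (coordContr q (k + 2) η) = coordContr q k (coordContr p (k + 2) η) := by
  conv_lhs => rw [coordContr_apply q]
  conv_rhs => rw [coordContr_apply q]
  simp only [map_smul, map_sum, coordContr_interior]

/-- The commutator of the contraction with components `p` and of alternatization,
`½ ∑ p^{ij} (ι_j (G e_i) - ι_i (G e_j))`. -/
def contrCommutator (p : Fin n → Fin n → ℝ) (G : Eu n →L[ℝ] Eu n [⋀^Fin (k + 1)]→L[ℝ] ℝ) :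
    Eu n [⋀^Fin k]→L[ℝ] ℝ :=
  (1 / 2 : ℝ) • ∑ i, ∑ j, p i j •
    (interior (stdVec j) k (G (stdVec i)) - interior (stdVec i) k (G (stdVec j)))

theorem contrCommutator_add (p : Fin n → Fin n → ℝ)
    (G H : Eu n →L[ℝ] Eu n [⋀^Fin (k + 1)]→L[ℝ] ℝ) :
    contrCommutator p (G + H) = contrCommutator p G + contrCommutator p H := by
  simp only [contrCommutator, add_apply, map_add, ← smul_add,
    ← Finset.sum_add_distrib]
  refine congrArg _ (Finset.sum_congr rfl fun i _ => Finset.sum_congr rfl fun j _ => congrArg _ ?_)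
  abel

theorem coordContr_contrCommutator (p : Fin n → Fin n → ℝ)
    (G : Eu n →L[ℝ] Eu n [⋀^Fin (k + 3)]→L[ℝ] ℝ) :
    coordContr p k (contrCommutator p G) = contrCommutator p (coordContr p (k + 1) ∘L G) := by
  simp only [contrCommutator, map_smul, map_sum, map_sub, coordContr_interior,
    ContinuousLinearMap.comp_apply]

theorem alternatizeUncurryFin_sum_smul_comp {m : ℕ} {ι : Type*} (s : Finset ι) (c : ι → ℝ)
    (L : ι → (Eu n [⋀^Fin m]→L[ℝ] ℝ) →L[ℝ] Eu n [⋀^Fin k]→L[ℝ] ℝ)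
    (G : Eu n →L[ℝ] Eu n [⋀^Fin m]→L[ℝ] ℝ) :
    alternatizeUncurryFin ((∑ i ∈ s, c i • L i) ∘L G) =
      ∑ i ∈ s, c i • alternatizeUncurryFin (L i ∘L G) := by
  have : (∑ i ∈ s, c i • L i) ∘L G = ∑ i ∈ s, c i • (L i ∘L G) := by
    ext; simp [sum_apply]
  rw [this]
  simp only [← alternatizeUncurryFinCLM_apply, map_sum, map_smul]

/-- Cartan's formula applied twice: `ι_j ι_i (A G) = ι_j (G e_i) - ι_i (G e_j) + A (ι_j ι_i G)`. The
last term rebuilds the contraction, and the first two form the commutator. -/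
theorem coordContr_alternatizeUncurryFin (p : Fin n → Fin n → ℝ)
    (G : Eu n →L[ℝ] Eu n [⋀^Fin (k + 2)]→L[ℝ] ℝ) :
    coordContr p (k + 1) (alternatizeUncurryFin G) =
      alternatizeUncurryFin (coordContr p k ∘L G) + contrCommutator p G := by
  have h : alternatizeUncurryFin (coordContr p k ∘L G) = (1 / 2 : ℝ) • ∑ i, ∑ j, p i j •
      alternatizeUncurryFin ((interior (stdVec j) k ∘L interior (stdVec i) (k + 1)) ∘L G) := by
    -- The double sum is flattened to a sum over pairs so that linearity of alternatization is used
    -- once.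
    rw [coordContr, ← Fintype.sum_prod_type', ContinuousLinearMap.smul_comp,
      alternatizeUncurryFin_smul, alternatizeUncurryFin_sum_smul_comp, Fintype.sum_prod_type]
  rw [h, coordContr_apply, contrCommutator, ← smul_add]
  simp only [← Finset.sum_add_distrib, ← smul_add]
  refine congrArg _ (Finset.sum_congr rfl fun i _ => Finset.sum_congr rfl fun j _ => congrArg _ ?_)
  rw [interior_alternatizeUncurryFin, map_sub, interior_alternatizeUncurryFin,
    ContinuousLinearMap.comp_apply, ContinuousLinearMap.comp_assoc]
  abel

theorem coordContr_alternatizeUncurryFin_zero (p : Fin n → Fin n → ℝ)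
    (G : Eu n →L[ℝ] Eu n [⋀^Fin 1]→L[ℝ] ℝ) :
    coordContr p 0 (alternatizeUncurryFin G) = contrCommutator p G := by
  rw [coordContr_apply, contrCommutator]
  refine congrArg _ (Finset.sum_congr rfl fun i _ => Finset.sum_congr rfl fun j _ => congrArg _ ?_)
  rw [interior_alternatizeUncurryFin, map_sub, interior_alternatizeUncurryFin_zero,
    ContinuousLinearMap.comp_apply]

/-- The derivative `x ↦ ½ ∑ q^{ij}(x) ι_j ι_i η` of a contraction with varying coefficients. -/
def coordContrDeriv (q : Fin n → Fin n → Eu n →L[ℝ] ℝ) (η : Eu n [⋀^Fin (k + 2)]→L[ℝ] ℝ) :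
    Eu n →L[ℝ] Eu n [⋀^Fin k]→L[ℝ] ℝ :=
  (1 / 2 : ℝ) • ∑ i, ∑ j, (q i j).smulRight
    (interior (stdVec j) k (interior (stdVec i) (k + 1) η))

theorem coordContrDeriv_apply (q : Fin n → Fin n → Eu n →L[ℝ] ℝ)
    (η : Eu n [⋀^Fin (k + 2)]→L[ℝ] ℝ) (x : Eu n) :
    coordContrDeriv q η x = coordContr (fun i j => q i j x) k η := by
  simp [coordContrDeriv, coordContr_apply, sum_apply]

theorem coordContr_comp_coordContrDeriv (p : Fin n → Fin n → ℝ)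
    (q : Fin n → Fin n → Eu n →L[ℝ] ℝ) (η : Eu n [⋀^Fin (k + 4)]→L[ℝ] ℝ) :
    coordContr p k ∘L coordContrDeriv q η = coordContrDeriv q (coordContr p (k + 2) η) := by
  ext1 x
  rw [ContinuousLinearMap.comp_apply, coordContrDeriv_apply, coordContrDeriv_apply, coordContr_comm]

/-- Leibniz rule: the first summand freezes the coefficients, the second freezes the form. -/
theorem hasFDerivAt_coordContr {c : Fin n → Fin n → Eu n → ℝ}
    {η : Eu n → Eu n [⋀^Fin (k + 2)]→L[ℝ] ℝ} {y : Eu n}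
    (hc : ∀ i j, DifferentiableAt ℝ (c i j) y) (hη : DifferentiableAt ℝ η y) :
    HasFDerivAt (fun z => coordContr (fun i j => c i j z) k (η z))
      (coordContr (fun i j => c i j y) k ∘L fderiv ℝ η y +
        coordContrDeriv (fun i j => fderiv ℝ (c i j) y) (η y)) y := by
  have h : ∀ i j, HasFDerivAt
      (fun z => c i j z • interior (stdVec j) k (interior (stdVec i) (k + 1) (η z)))
      (c i j y • (interior (stdVec j) k ∘L interior (stdVec i) (k + 1)) ∘L fderiv ℝ η y +
        (fderiv ℝ (c i j) y).smulRight (interior (stdVec j) k (interior (stdVec i) (k + 1) (η y)))) y :=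
    fun i j => (hc i j).hasFDerivAt.smul
      (((interior (stdVec j) k ∘L interior (stdVec i) (k + 1)).hasFDerivAt).comp y hη.hasFDerivAt)
  have h' := (HasFDerivAt.fun_sum fun i (_ : i ∈ Finset.univ) =>
    HasFDerivAt.fun_sum fun j (_ : j ∈ Finset.univ) => h i j).fun_const_smul (1 / 2 : ℝ)
  simp only [← coordContr_apply] at h'
  refine h'.congr_fderiv ?_
  ext1 x
  simp [coordContrDeriv, coordContr_apply, sum_apply, Finset.sum_add_distrib]

theorem interior_cyclic (a b c : Eu n) (η : Eu n [⋀^Fin (k + 3)]→L[ℝ] ℝ) :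
    interior a k (interior b (k + 1) (interior c (k + 2) η)) =
      interior c k (interior a (k + 1) (interior b (k + 2) η)) := by
  rw [interior_interior b c, map_neg, interior_interior a c, neg_neg]

theorem sum_rotate {V : Type*} [AddCommMonoid V] (f : Fin n → Fin n → Fin n → V) :
    ∑ i, ∑ j, ∑ l, f j l i = ∑ i, ∑ j, ∑ l, f i j l := by
  rw [Finset.sum_comm]
  exact Finset.sum_congr rfl fun j _ => Finset.sum_comm

/-- Rotating the summation indices moves the rotation from `W` to `S`. Three times the sum therefore
carries the cyclic sum of `S` as coefficient. -/
theorem sum_smul_eq_zero_of_cyclic {V : Type*} [AddCommGroup V] [Module ℝ V]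
    (S : Fin n → Fin n → Fin n → ℝ) (W : Fin n → Fin n → Fin n → V)
    (hS : ∀ i j l, S i j l + S j l i + S l i j = 0) (hW : ∀ i j l, W j l i = W i j l) :
    ∑ i, ∑ j, ∑ l, S i j l • W i j l = 0 := by
  have e1 : ∑ i, ∑ j, ∑ l, S j l i • W i j l = ∑ i, ∑ j, ∑ l, S i j l • W i j l := by
    rw [← sum_rotate fun i j l => S i j l • W i j l]
    simp only [hW]
  have e2 : ∑ i, ∑ j, ∑ l, S l i j • W i j l = ∑ i, ∑ j, ∑ l, S i j l • W i j l := by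
    rw [← e1, ← sum_rotate fun i j l => S j l i • W i j l]
    simp only [hW]
  have h : (3 : ℝ) • ∑ i, ∑ j, ∑ l, S i j l • W i j l = 0 := by
    calc (3 : ℝ) • ∑ i, ∑ j, ∑ l, S i j l • W i j l
        = ∑ i, ∑ j, ∑ l, (S i j l + S j l i + S l i j) • W i j l := by
          simp only [add_smul, Finset.sum_add_distrib, e1, e2]
          module
      _ = 0 := by simp [hS]
  exact (smul_eq_zero.1 h).resolve_left (by norm_num)

/-- By antisymmetry the two halves of the commutator agree after exchanging `i` and `j`, which
absorbs the factor `1/2`. -/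
theorem contrCommutator_eq_of_antisymm {p : Fin n → Fin n → ℝ} (hp : ∀ i j, p i j = -p j i)
    (G : Eu n →L[ℝ] Eu n [⋀^Fin (k + 1)]→L[ℝ] ℝ) :
    contrCommutator p G = -∑ j, ∑ i, p j i • interior (stdVec j) k (G (stdVec i)) := by
  have h : ∑ i, ∑ j, p i j • interior (stdVec j) k (G (stdVec i)) =
      -∑ j, ∑ i, p j i • interior (stdVec j) k (G (stdVec i)) := by
    rw [Finset.sum_comm, ← Finset.sum_neg_distrib]
    refine Finset.sum_congr rfl fun j _ => ?_
    rw [← Finset.sum_neg_distrib]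
    exact Finset.sum_congr rfl fun i _ => by rw [hp i j]; module
  simp only [contrCommutator, smul_sub, Finset.sum_sub_distrib, h]
  module

/-- The commutator term vanishes for the derivative of a contraction whose coefficients satisfy the
Jacobi identity. -/
theorem contrCommutator_coordContrDeriv_eq_zero {p : Fin n → Fin n → ℝ}
    {q : Fin n → Fin n → Eu n →L[ℝ] ℝ} (hp : ∀ i j, p i j = -p j i)
    (hpq : ∀ i j l, ∑ m, p i m * q j l (stdVec m) + ∑ m, p j m * q l i (stdVec m) +
      ∑ m, p l m * q i j (stdVec m) = 0) (η : Eu n [⋀^Fin (k + 3)]→L[ℝ] ℝ) :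
    contrCommutator p (coordContrDeriv q η) = 0 := by
  -- The weights are triple interior products, unchanged by a rotation because it is an even
  -- permutation; `hpq` is the required cyclic identity.
  have h := sum_smul_eq_zero_of_cyclic (fun j a b => ∑ m, p j m * q a b (stdVec m))
    (fun j a b => interior (stdVec j) k (interior (stdVec b) (k + 1) (interior (stdVec a) (k + 2) η)))
    hpq fun i j l => by rw [interior_cyclic, interior_cyclic]
  have h' : ∑ j, ∑ m, p j m • interior (stdVec j) k (coordContrDeriv q η (stdVec m)) =
      (1 / 2 : ℝ) • ∑ j, ∑ a, ∑ b, (∑ m, p j m * q a b (stdVec m)) • interior (stdVec j) k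
        (interior (stdVec b) (k + 1) (interior (stdVec a) (k + 2) η)) := by
    rw [Finset.smul_sum]
    refine Finset.sum_congr rfl fun j _ => ?_
    simp only [coordContrDeriv_apply, coordContr_apply, map_smul, map_sum, Finset.sum_smul,
      smul_comm (p j _) (1 / 2 : ℝ), Finset.smul_sum, mul_smul]
    rw [Finset.sum_comm]
    exact Finset.sum_congr rfl fun a _ => Finset.sum_comm
  rw [contrCommutator_eq_of_antisymm hp, h', h, smul_zero, neg_zero]

/-- The pointwise form of `2 i d i = i i d + d i i` in degree at least `4`. -/
theorem two_smul_coordContr_alternatize {p : Fin n → Fin n → ℝ}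
    {q : Fin n → Fin n → Eu n →L[ℝ] ℝ} (η : Eu n [⋀^Fin (k + 4)]→L[ℝ] ℝ)
    (hK : contrCommutator p (coordContrDeriv q η) = 0)
    (F : Eu n →L[ℝ] Eu n [⋀^Fin (k + 4)]→L[ℝ] ℝ) :
    (2 : ℝ) • coordContr p (k + 1)
        (alternatizeUncurryFin (coordContr p (k + 2) ∘L F + coordContrDeriv q η)) =
      coordContr p (k + 1) (coordContr p (k + 3) (alternatizeUncurryFin F)) +
        alternatizeUncurryFin (coordContr p k ∘L (coordContr p (k + 2) ∘L F + coordContrDeriv q η) +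
          coordContrDeriv q (coordContr p (k + 2) η)) := by
  -- With `i` the contraction, `Q` the coefficient-derivative term and `K` the commutator, the left
  -- side becomes `2 A(i i F) + 2 A(i Q) + 2 K(i F)`. On the right, `i i A F` contributes `A(i i F)
  -- + 2 K(i F)` and the other summand contributes `A(i i F) + 2 A(i Q)`.
  rw [coordContr_alternatizeUncurryFin p F, map_add, coordContr_contrCommutator,
    coordContr_alternatizeUncurryFin p (coordContr p (k + 2) ∘L F),
    coordContr_alternatizeUncurryFin, contrCommutator_add, hK, ContinuousLinearMap.comp_add,
    coordContr_comp_coordContrDeriv]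
  simp only [ContinuousAlternatingMap.alternatizeUncurryFin_add]
  module

/-- The pointwise form of `2 i d i = i i d` on `3`-forms. -/
theorem two_smul_coordContr_alternatize_zero {p : Fin n → Fin n → ℝ}
    {q : Fin n → Fin n → Eu n →L[ℝ] ℝ} (η : Eu n [⋀^Fin 3]→L[ℝ] ℝ)
    (hK : contrCommutator p (coordContrDeriv q η) = 0)
    (F : Eu n →L[ℝ] Eu n [⋀^Fin 3]→L[ℝ] ℝ) :
    (2 : ℝ) • coordContr p 0
        (alternatizeUncurryFin (coordContr p 1 ∘L F + coordContrDeriv q η)) =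
      coordContr p 0 (coordContr p 2 (alternatizeUncurryFin F)) := by
  rw [coordContr_alternatizeUncurryFin p F, map_add, coordContr_contrCommutator,
    coordContr_alternatizeUncurryFin_zero, coordContr_alternatizeUncurryFin_zero,
    contrCommutator_add, hK]
  module

end Contraction

/-! ### Transfer of the pointwise identities to the manifold through charts. -/

section Charts

variable {n : ℕ} {M : Type*} [TopologicalSpace M] [ChartedSpace (Eu n) M]

theorem coeff_antisymm (e : OpenPartialHomeomorph M (Eu n)) (Λ : BivectorField n M) (i j : Fin n)
    (y : Eu n) : coeff e Λ i j y = -coeff e Λ j i y := by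
  unfold coeff
  rw [← (Λ (e.symm y)).map_swap _ (i := 0) (j := 1) (by simp)]
  congr 1
  ext l
  fin_cases l <;> rfl

/-- In `[Λ, Λ]` both arguments agree, so each term of the Jacobi sum occurs twice. -/
theorem sum_coeff_mul_fderiv_eq_zero {Λ : Bivector n M} (hΛ : Λ.IsPoisson) (p : M) {y : Eu n}
    (hy : y ∈ (chartAt (Eu n) p).target) (i j l : Fin n) :
    ∑ m, coeff (chartAt (Eu n) p) Λ.toFun i m y *
        fderiv ℝ (coeff (chartAt (Eu n) p) Λ.toFun j l) y (stdVec m) +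
      ∑ m, coeff (chartAt (Eu n) p) Λ.toFun j m y *
        fderiv ℝ (coeff (chartAt (Eu n) p) Λ.toFun l i) y (stdVec m) +
      ∑ m, coeff (chartAt (Eu n) p) Λ.toFun l m y *
        fderiv ℝ (coeff (chartAt (Eu n) p) Λ.toFun i j) y (stdVec m) = 0 := by
  have h := hΛ p y hy i j l
  simp only [schouten, Finset.sum_add_distrib] at h
  linarith

theorem DiffForm.contDiffAt_pullForm {k : ℕ} (α : DiffForm n M k) (p : M) {y : Eu n}
    (hy : y ∈ (chartAt (Eu n) p).target) :
    ContDiffAt ℝ ∞ (pullForm (chartAt (Eu n) p).symm α.toFun) y :=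
  (α.smooth p).contDiffAt ((chartAt (Eu n) p).open_target.mem_nhds hy)

theorem Bivector.IsPoisson.contrCommutator_eq_zero {Λ : Bivector n M} (hΛ : Λ.IsPoisson) {k : ℕ} (p : M) {y : Eu n}
    (hy : y ∈ (chartAt (Eu n) p).target) (η : Eu n [⋀^Fin (k + 3)]→L[ℝ] ℝ) :
    contrCommutator (fun i j => coeff (chartAt (Eu n) p) Λ.toFun i j y)
      (coordContrDeriv (fun i j => fderiv ℝ (coeff (chartAt (Eu n) p) Λ.toFun i j) y) η) = 0 :=
  contrCommutator_coordContrDeriv_eq_zero (fun i j => coeff_antisymm _ _ i j y)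
    (fun i j l => sum_coeff_mul_fderiv_eq_zero hΛ p hy i j l) η

variable [IsManifold (𝓡 n) ∞ M]

/-- The differential of a chart is invertible, so evaluating the pull-back on the images of tangent
vectors recovers the form. -/
theorem FormField.ext_pullForm {k : ℕ} {α β : FormField n M k}
    (h : ∀ p : M, ∀ y ∈ (chartAt (Eu n) p).target,
      pullForm (chartAt (Eu n) p).symm α y = pullForm (chartAt (Eu n) p).symm β y) : α = β := by
  funext x
  have hx := mem_chart_source (Eu n) x
  have hy := (chartAt (Eu n) x).map_source hx
  -- The point is made a variable because the type of `α z` depends on it, so rewriting by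
  -- `left_inv` directly is awkward.
  have key : ∀ z, z = (chartAt (Eu n) x).symm (chartAt (Eu n) x x) → α z = β z := by
    rintro _ rfl
    have h1 := (mdifferentiable_chart (I := 𝓡 n) x).symm_comp_deriv
      ((chartAt (Eu n) x).map_target hy)
    rw [(chartAt (Eu n) x).right_inv hy] at h1
    ext v
    have h2 := congrArg (fun A : Eu n [⋀^Fin k]→L[ℝ] ℝ => A fun i => (mfderiv (𝓡 n) (𝓡 n)
      (chartAt (Eu n) x) ((chartAt (Eu n) x).symm (chartAt (Eu n) x x)) : Eu n →L[ℝ] Eu n) (v i))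
      (h x _ hy)
    have h3 : (fun i => (mfderiv (𝓡 n) (𝓡 n) (chartAt (Eu n) x).symm (chartAt (Eu n) x x) :
        Eu n →L[ℝ] Eu n) ((mfderiv (𝓡 n) (𝓡 n) (chartAt (Eu n) x)
          ((chartAt (Eu n) x).symm (chartAt (Eu n) x x)) : Eu n →L[ℝ] Eu n) (v i))) = v :=
      funext fun i => congrArg (fun f : Eu n →L[ℝ] Eu n => f (v i)) h1
    have h4 : ∀ γ : FormField n M k, (pullForm (chartAt (Eu n) x).symm γ (chartAt (Eu n) x x))
        (fun i => (mfderiv (𝓡 n) (𝓡 n) (chartAt (Eu n) x)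
          ((chartAt (Eu n) x).symm (chartAt (Eu n) x x)) : Eu n →L[ℝ] Eu n) (v i)) =
        γ ((chartAt (Eu n) x).symm (chartAt (Eu n) x x)) v := fun γ =>
      congrArg (γ ((chartAt (Eu n) x).symm (chartAt (Eu n) x x))) h3
    exact (h4 α).symm.trans (h2.trans (h4 β))
  exact key x ((chartAt (Eu n) x).left_inv hx).symm

theorem pullForm_contraction (Λ : Bivector n M) {k : ℕ} (α : DiffForm n M (k + 2)) (p : M)
    {y : Eu n} (hy : y ∈ (chartAt (Eu n) p).target) :
    pullForm (chartAt (Eu n) p).symm (contraction Λ k α).toFun y =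
      coordContr (fun i j => coeff (chartAt (Eu n) p) Λ.toFun i j y) k
        (pullForm (chartAt (Eu n) p).symm α.toFun y) := by
  rw [coordContr_apply]
  exact pullForm_contrField Λ.toFun α.toFun p hy

theorem pullForm_extD {k : ℕ} (α : DiffForm n M k) (p : M) {y : Eu n}
    (hy : y ∈ (chartAt (Eu n) p).target) :
    pullForm (chartAt (Eu n) p).symm (extD k α).toFun y =
      extDeriv (pullForm (chartAt (Eu n) p).symm α.toFun) y :=
  pullForm_extDerivField α.smooth p hy

theorem hasFDerivAt_pullForm_contraction (Λ : Bivector n M) {k : ℕ} (α : DiffForm n M (k + 2))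
    (p : M) {y : Eu n} (hy : y ∈ (chartAt (Eu n) p).target) :
    HasFDerivAt (pullForm (chartAt (Eu n) p).symm (contraction Λ k α).toFun)
      (coordContr (fun i j => coeff (chartAt (Eu n) p) Λ.toFun i j y) k ∘L
          fderiv ℝ (pullForm (chartAt (Eu n) p).symm α.toFun) y +
        coordContrDeriv (fun i j => fderiv ℝ (coeff (chartAt (Eu n) p) Λ.toFun i j) y)
          (pullForm (chartAt (Eu n) p).symm α.toFun y)) y := by
  have hc : ∀ i j, DifferentiableAt ℝ (coeff (chartAt (Eu n) p) Λ.toFun i j) y := fun i j =>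
    ((Λ.smooth p i j).contDiffAt ((chartAt (Eu n) p).open_target.mem_nhds hy)).differentiableAt
      (by simp)
  refine (hasFDerivAt_coordContr hc
    ((α.contDiffAt_pullForm p hy).differentiableAt (by simp))).congr_of_eventuallyEq ?_
  filter_upwards [(chartAt (Eu n) p).open_target.mem_nhds hy] with z hz
  exact pullForm_contraction Λ α p hz

theorem extD_extD {k : ℕ} (α : DiffForm n M k) : extD (k + 1) (extD k α) = 0 := by
  refine DiffForm.ext (FormField.ext_pullForm fun p y hy => ?_)
  -- The chart formula is needed near `y`, not only at `y`, since it is differentiated again.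
  have h : pullForm (chartAt (Eu n) p).symm (extD k α).toFun =ᶠ[𝓝 y]
      extDeriv (pullForm (chartAt (Eu n) p).symm α.toFun) := by
    filter_upwards [(chartAt (Eu n) p).open_target.mem_nhds hy] with z hz
    exact pullForm_extD α p hz
  rw [pullForm_extD _ p hy, h.extDeriv_eq, extDeriv_extDeriv_apply (α.contDiffAt_pullForm p hy)
    (by rw [minSmoothness_of_isRCLikeNormedField]; exact WithTop.coe_le_coe.2 le_top)]
  rfl

variable {Λ : Bivector n M}

/-- For a Poisson structure, `2 i(Λ) d i(Λ) = i(Λ) i(Λ) d + d i(Λ) i(Λ)` in degree at least `4`. -/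
theorem Bivector.IsPoisson.two_smul_contraction_extD_contraction (hΛ : Λ.IsPoisson) {k : ℕ}
    (α : DiffForm n M (k + 4)) :
    (2 : ℝ) • contraction Λ (k + 1) (extD (k + 2) (contraction Λ (k + 2) α)) =
      contraction Λ (k + 1) (contraction Λ (k + 3) (extD (k + 4) α)) +
        extD k (contraction Λ k (contraction Λ (k + 2) α)) := by
  refine DiffForm.ext (FormField.ext_pullForm fun p y hy => ?_)
  have h := two_smul_coordContr_alternatize _ (hΛ.contrCommutator_eq_zero p hy
    (pullForm (chartAt (Eu n) p).symm α.toFun y))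
    (fderiv ℝ (pullForm (chartAt (Eu n) p).symm α.toFun) y)
  -- Read backwards, the Leibniz rule recognizes the inner expression as the derivative of `i(Λ) α`,
  -- and then the outer one as that of `i(Λ) i(Λ) α`.
  rw [← (hasFDerivAt_pullForm_contraction Λ α p hy).fderiv, ← pullForm_contraction Λ α p hy,
    ← (hasFDerivAt_pullForm_contraction Λ (contraction Λ (k + 2) α) p hy).fderiv] at h
  -- `extDeriv` is by definition the alternatization of `fderiv`.
  change _ • coordContr _ _ (extDeriv _ y) = coordContr _ _ (coordContr _ _ (extDeriv _ y)) +
    extDeriv _ y at h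
  rw [← pullForm_extD _ p hy, ← pullForm_extD _ p hy, ← pullForm_extD _ p hy] at h
  have e1 := pullForm_contraction Λ (k := k + 1) (extD (k + 2) (contraction Λ (k + 2) α)) p hy
  have e2 := pullForm_contraction Λ (k := k + 3) (extD (k + 4) α) p hy
  have e3 := pullForm_contraction Λ (k := k + 1) (contraction Λ (k + 3) (extD (k + 4) α)) p hy
  rw [e2] at e3
  rw [← e1, ← e3] at h
  exact h

/-- For a Poisson structure, `2 i(Λ) d i(Λ) = i(Λ) i(Λ) d` on `3`-forms. -/
theorem Bivector.IsPoisson.two_smul_contraction_extD_contraction_zero (hΛ : Λ.IsPoisson)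
    (α : DiffForm n M 3) :
    (2 : ℝ) • contraction Λ 0 (extD 1 (contraction Λ 1 α)) =
      contraction Λ 0 (contraction Λ 2 (extD 3 α)) := by
  refine DiffForm.ext (FormField.ext_pullForm fun p y hy => ?_)
  have h := two_smul_coordContr_alternatize_zero _ (hΛ.contrCommutator_eq_zero p hy
    (pullForm (chartAt (Eu n) p).symm α.toFun y))
    (fderiv ℝ (pullForm (chartAt (Eu n) p).symm α.toFun) y)
  rw [← (hasFDerivAt_pullForm_contraction Λ α p hy).fderiv] at h
  change _ • coordContr _ _ (extDeriv _ y) = coordContr _ _ (coordContr _ _ (extDeriv _ y)) at h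
  rw [← pullForm_extD _ p hy, ← pullForm_extD _ p hy] at h
  have e1 := pullForm_contraction Λ (k := 0) (extD 1 (contraction Λ 1 α)) p hy
  have e2 := pullForm_contraction Λ (k := 2) (extD 3 α) p hy
  have e3 := pullForm_contraction Λ (k := 0) (contraction Λ 2 (extD 3 α)) p hy
  rw [e2] at e3
  rw [← e1, ← e3] at h
  exact h

end Charts

/-! ### Operator identities on inhomogeneous forms, and the two complexes. -/

section GradedIdentities

variable {n : ℕ} {M : Type*} [TopologicalSpace M] [ChartedSpace (Eu n) M]

theorem signForms_apply (α : Forms n M) (k : ℕ) : signForms α k = (-1 : ℝ) ^ k • α k := rfl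

theorem signForms_of_mem {k : ℤ} {α : Forms n M} (hα : α ∈ formsOfDegree n M k) :
    signForms α = (-1 : ℝ) ^ k • α := by
  funext j
  by_cases h : (j : ℤ) = k
  · subst h
    rw [signForms_apply, Pi.smul_apply, zpow_natCast]
  · rw [signForms_apply, Pi.smul_apply, hα j h, smul_zero, smul_zero]

theorem signForms_mem {k : ℤ} {α : Forms n M} (hα : α ∈ formsOfDegree n M k) :
    signForms α ∈ formsOfDegree n M k := by
  rw [signForms_of_mem hα]
  exact Submodule.smul_mem _ _ hα

variable [IsManifold (𝓡 n) ∞ M] {Λ : Bivector n M}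

theorem dForms_dForms (α : Forms n M) : dForms (dForms α) = 0 := by
  funext k
  match k with
  | 0 => rfl
  | 1 => exact map_zero (extD 0)
  | k + 2 => exact extD_extD (α k)

theorem Bivector.IsPoisson.two_smul_iForms_dForms_iForms (hΛ : Λ.IsPoisson) (α : Forms n M) :
    (2 : ℝ) • iForms Λ (dForms (iForms Λ α)) =
      iForms Λ (iForms Λ (dForms α)) + dForms (iForms Λ (iForms Λ α)) := by
  funext k
  match k with
  -- The operators lower degree by `3`, so component `0` comes from `α 3`; there the summand `d i i`
  -- is absent because `d` has no component in degree `0`.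
  | 0 => exact (hΛ.two_smul_contraction_extD_contraction_zero (α 3)).trans (add_zero _).symm
  | k + 1 => exact hΛ.two_smul_contraction_extD_contraction (α (k + 4))

theorem canBoundary_apply (α : Forms n M) :
    canBoundary Λ α = iForms Λ (dForms α) - dForms (iForms Λ α) := rfl

/-- The difference of the two sides is `2 i d i - d i i - i i d`. -/
theorem Bivector.IsPoisson.canBoundary_iForms (hΛ : Λ.IsPoisson) (α : Forms n M) :
    canBoundary Λ (iForms Λ α) = iForms Λ (canBoundary Λ α) := by
  have h := hΛ.two_smul_iForms_dForms_iForms α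
  rw [two_smul] at h
  rw [canBoundary_apply, canBoundary_apply, map_sub, sub_eq_sub_iff_add_eq_add, h]

theorem Bivector.IsPoisson.canBoundary_canBoundary (hΛ : Λ.IsPoisson) (α : Forms n M) :
    canBoundary Λ (canBoundary Λ α) = 0 := by
  -- With `d² = 0` these read `2 d i d i = d i i d` and `2 i d i d = d i i d`, which is what the
  -- expansion of `2 δ̄²` needs.
  have h1 := congrArg dForms (hΛ.two_smul_iForms_dForms_iForms α)
  have h2 := hΛ.two_smul_iForms_dForms_iForms (dForms α)
  simp only [map_smul, map_add, dForms_dForms, map_zero, add_zero, zero_add] at h1 h2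
  have h : (2 : ℝ) • canBoundary Λ (canBoundary Λ α) = 0 := by
    simp only [canBoundary_apply, map_sub, dForms_dForms, map_zero, smul_sub, h1, h2,
      smul_zero]
    module
  exact (smul_eq_zero.1 h).resolve_left two_ne_zero

theorem iForms_signForms (α : Forms n M) : iForms Λ (signForms α) = signForms (iForms Λ α) := by
  funext k
  refine ((contraction Λ k).map_smul ((-1 : ℝ) ^ (k + 2)) (α (k + 2))).trans ?_
  rw [pow_add, neg_one_sq, mul_one]
  rfl

theorem dForms_signForms (α : Forms n M) : dForms (signForms α) = -signForms (dForms α) := by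
  funext k
  match k with
  | 0 => exact ((congrArg Neg.neg (smul_zero ((-1 : ℝ) ^ 0))).trans neg_zero).symm
  | k + 1 =>
    refine ((extD k).map_smul ((-1 : ℝ) ^ k) (α k)).trans ?_
    rw [Pi.neg_apply, signForms_apply, pow_succ, mul_neg, mul_one, neg_smul, neg_neg]
    rfl

/-- `δ̄` changes degree by one, hence reverses parity. -/
theorem canBoundary_signForms (α : Forms n M) :
    canBoundary Λ (signForms α) = -signForms (canBoundary Λ α) := by
  simp only [canBoundary_apply, dForms_signForms, iForms_signForms, map_neg, map_sub]
  abel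

theorem ljBoundary_apply (α β : Forms n M) :
    ljBoundary Λ (α, β) = (canBoundary Λ α, canBoundary Λ β + iForms Λ (signForms α)) := rfl

theorem Bivector.IsPoisson.ljBoundary_ljBoundary (hΛ : Λ.IsPoisson) (x : Forms n M × Forms n M) :
    ljBoundary Λ (ljBoundary Λ x) = 0 := by
  obtain ⟨α, β⟩ := x
  rw [ljBoundary_apply, ljBoundary_apply, map_add, hΛ.canBoundary_canBoundary,
    hΛ.canBoundary_canBoundary, hΛ.canBoundary_iForms, canBoundary_signForms, map_neg, zero_add,
    neg_add_cancel]
  rfl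

theorem dForms_mem {k : ℤ} {α : Forms n M} (hα : α ∈ formsOfDegree n M k) :
    dForms α ∈ formsOfDegree n M (k + 1) := by
  intro j hj
  match j with
  | 0 => rfl
  | j + 1 =>
    refine (congrArg (extD j) (hα j ?_)).trans (map_zero _)
    push_cast at hj
    omega

theorem iForms_mem {k : ℤ} {α : Forms n M} (hα : α ∈ formsOfDegree n M k) :
    iForms Λ α ∈ formsOfDegree n M (k - 2) := by
  intro j hj
  refine (congrArg (contraction Λ j) (hα (j + 2) ?_)).trans (map_zero _)
  push_cast
  omega

theorem canBoundary_mem {k : ℤ} {α : Forms n M} (hα : α ∈ formsOfDegree n M k) :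
    canBoundary Λ α ∈ formsOfDegree n M (k - 1) := by
  have h1 := iForms_mem (Λ := Λ) (dForms_mem hα)
  have h2 := dForms_mem (iForms_mem (Λ := Λ) hα)
  rw [show k + 1 - 2 = k - 1 by ring] at h1
  rw [show k - 2 + 1 = k - 1 by ring] at h2
  exact Submodule.sub_mem _ h1 h2

theorem ljBoundary_mem {k : ℤ} {x : Forms n M × Forms n M} (hx : x ∈ pairsOfDegree n M k) :
    ljBoundary Λ x ∈ pairsOfDegree n M (k - 1) := by
  have h := iForms_mem (Λ := Λ) (signForms_mem hx.1)
  rw [show k - 2 = k - 1 - 1 by ring] at h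
  exact ⟨canBoundary_mem hx.1, Submodule.add_mem _ (canBoundary_mem hx.2) h⟩

theorem Bivector.IsPoisson.isComplex_canBoundary (hΛ : Λ.IsPoisson) :
    IsComplex (formsOfDegree n M) (canBoundary Λ) :=
  fun _ α hα => ⟨canBoundary_mem hα, hΛ.canBoundary_canBoundary α⟩

theorem Bivector.IsPoisson.isComplex_ljBoundary (hΛ : Λ.IsPoisson) :
    IsComplex (pairsOfDegree n M) (ljBoundary Λ) :=
  fun _ x hx => ⟨ljBoundary_mem hx, hΛ.ljBoundary_ljBoundary x⟩

end GradedIdentities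

/-! ### Homology classes and induced maps. -/

section HomologyMap

variable {T T' : Type*} [AddCommGroup T] [Module ℝ T] [AddCommGroup T'] [Module ℝ T']
  {G : ℤ → Submodule ℝ T} {D : T →ₗ[ℝ] T} {G' : ℤ → Submodule ℝ T'} {D' : T' →ₗ[ℝ] T'} {k k' : ℤ}

theorem homologyClass_surjective : Function.Surjective (homologyClass G D k) :=
  Submodule.mkQ_surjective _

theorem homologyClass_eq_zero_iff {z : cycles G D k} :
    homologyClass G D k z = 0 ↔ (z : T) ∈ boundaries G D k :=
  Submodule.Quotient.mk_eq_zero _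

theorem homologyClass_eq_iff {z w : cycles G D k} :
    homologyClass G D k z = homologyClass G D k w ↔ (z : T) - w ∈ boundaries G D k := by
  rw [← sub_eq_zero, ← map_sub, homologyClass_eq_zero_iff, Submodule.coe_sub]

/-- The map on homology induced by a linear map that preserves cycles and boundaries. -/
def homologyMap (f : T →ₗ[ℝ] T') (hc : ∀ z ∈ cycles G D k, f z ∈ cycles G' D' k')
    (hb : ∀ z ∈ boundaries G D k, f z ∈ boundaries G' D' k') :
    Homology G D k →ₗ[ℝ] Homology G' D' k' :=
  Submodule.mapQ _ _ (f.restrict hc) fun z hz => hb z hz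

end HomologyMap

/-! ### The maps of the long sequence and its exactness. -/

section LongExactSequence

variable {n : ℕ} {M : Type*} [TopologicalSpace M] [ChartedSpace (Eu n) M]

theorem inr_mem_pairsOfDegree {k : ℤ} {β : Forms n M} (hβ : β ∈ formsOfDegree n M (k - 1)) :
    ((0, β) : Forms n M × Forms n M) ∈ pairsOfDegree n M k :=
  ⟨Submodule.zero_mem _, hβ⟩

variable [IsManifold (𝓡 n) ∞ M] {Λ : Bivector n M}

theorem ljBoundary_zero_left (β : Forms n M) :
    ljBoundary Λ (0, β) = (0, canBoundary Λ β) := by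
  rw [ljBoundary_apply]
  simp

theorem ljBoundary_zero_right (α : Forms n M) :
    ljBoundary Λ (α, 0) = (canBoundary Λ α, iForms Λ (signForms α)) := by
  rw [ljBoundary_apply]
  simp

theorem inr_mem_ljCycles {k : ℤ} {β : Forms n M} (hβ : β ∈ canCycles Λ (k - 1)) :
    ((0, β) : Forms n M × Forms n M) ∈ ljCycles Λ k := by
  refine ⟨inr_mem_pairsOfDegree hβ.1, ?_⟩
  rw [SetLike.mem_coe, LinearMap.mem_ker, ljBoundary_zero_left, LinearMap.mem_ker.1 hβ.2]
  rfl

theorem inr_mem_ljBoundaries {k : ℤ} {β : Forms n M}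
    (hβ : β ∈ boundaries (formsOfDegree n M) (canBoundary Λ) (k - 1)) :
    ((0, β) : Forms n M × Forms n M) ∈ boundaries (pairsOfDegree n M) (ljBoundary Λ) k := by
  obtain ⟨γ, hγ, rfl⟩ := hβ
  rw [show k - 1 + 1 = k + 1 - 1 by ring] at hγ
  exact ⟨(0, γ), inr_mem_pairsOfDegree hγ, ljBoundary_zero_left γ⟩

theorem fst_mem_canCycles {k : ℤ} {x : Forms n M × Forms n M} (hx : x ∈ ljCycles Λ k) :
    x.1 ∈ canCycles Λ k :=
  ⟨hx.1.1, congrArg Prod.fst (LinearMap.mem_ker.1 hx.2)⟩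

theorem fst_mem_canBoundaries {k : ℤ} {x : Forms n M × Forms n M}
    (hx : x ∈ boundaries (pairsOfDegree n M) (ljBoundary Λ) k) :
    x.1 ∈ boundaries (formsOfDegree n M) (canBoundary Λ) k := by
  obtain ⟨y, hy, rfl⟩ := hx
  exact ⟨y.1, hy.1, rfl⟩

theorem Bivector.IsPoisson.iForms_mem_canCycles (hΛ : Λ.IsPoisson) {k : ℤ} {α : Forms n M}
    (hα : α ∈ canCycles Λ (k + 1)) : iForms Λ α ∈ canCycles Λ (k - 1) := by
  have h := iForms_mem (Λ := Λ) hα.1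
  rw [show k + 1 - 2 = k - 1 by ring] at h
  refine ⟨h, ?_⟩
  rw [SetLike.mem_coe, LinearMap.mem_ker, hΛ.canBoundary_iForms, LinearMap.mem_ker.1 hα.2, map_zero]

theorem signForms_mem_canCycles {k : ℤ} {α : Forms n M} (hα : α ∈ canCycles Λ k) :
    signForms α ∈ canCycles Λ k := by
  refine ⟨signForms_mem hα.1, ?_⟩
  rw [SetLike.mem_coe, LinearMap.mem_ker, canBoundary_signForms, LinearMap.mem_ker.1 hα.2, map_zero, neg_zero]

theorem Bivector.IsPoisson.iForms_signForms_mem_canBoundaries (hΛ : Λ.IsPoisson) {k : ℤ}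
    {α : Forms n M} (hα : α ∈ boundaries (formsOfDegree n M) (canBoundary Λ) (k + 1)) :
    iForms Λ (signForms α) ∈ boundaries (formsOfDegree n M) (canBoundary Λ) (k - 1) := by
  obtain ⟨γ, hγ, rfl⟩ := hα
  have h := iForms_mem (Λ := Λ) (signForms_mem hγ)
  rw [show k + 1 + 1 - 2 = k - 1 + 1 by ring] at h
  -- The sign compensates `s δ̄ = -δ̄ s`: one has `i s δ̄ γ = -δ̄ (i s γ)`.
  refine ⟨-iForms Λ (signForms γ), Submodule.neg_mem _ h, ?_⟩
  rw [map_neg, hΛ.canBoundary_iForms, canBoundary_signForms, map_neg, neg_neg]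

variable (Λ) in
/-- The map `H^{can}_{k-1}(M) → H^{LJ}_k(M)` induced by `β ↦ (0, β)`. -/
def inrHomology (k : ℤ) : HCan Λ (k - 1) →ₗ[ℝ] HLJ Λ k :=
  homologyMap (LinearMap.inr ℝ (Forms n M) (Forms n M)) (fun _ h => inr_mem_ljCycles h)
    fun _ h => inr_mem_ljBoundaries h

variable (Λ) in
/-- The map `H^{LJ}_k(M) → H^{can}_k(M)` induced by `(α, β) ↦ α`. -/
def fstHomology (k : ℤ) : HLJ Λ k →ₗ[ℝ] HCan Λ k :=
  homologyMap (LinearMap.fst ℝ (Forms n M) (Forms n M)) (fun _ h => fst_mem_canCycles h)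
    fun _ h => fst_mem_canBoundaries h

/-- The connecting homomorphism `H^{can}_{k+1}(M) → H^{can}_{k-1}(M)`,
`[α] ↦ (-1)^{k+1} [i(Λ) α]`. -/
def connecting (hΛ : Λ.IsPoisson) (k : ℤ) : HCan Λ (k + 1) →ₗ[ℝ] HCan Λ (k - 1) :=
  homologyMap (iForms Λ ∘ₗ signForms)
    (fun _ h => hΛ.iForms_mem_canCycles (signForms_mem_canCycles h))
    fun _ h => hΛ.iForms_signForms_mem_canBoundaries h

theorem inrHomology_canClass (k : ℤ) (z : canCycles Λ (k - 1)) :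
    inrHomology Λ k (canClass Λ (k - 1) z) = ljClass Λ k ⟨(0, z), inr_mem_ljCycles z.2⟩ := rfl

theorem fstHomology_ljClass (k : ℤ) (w : ljCycles Λ k) :
    fstHomology Λ k (ljClass Λ k w) =
      canClass Λ k ⟨(w : Forms n M × Forms n M).1, fst_mem_canCycles w.2⟩ := rfl

theorem connecting_canClass (hΛ : Λ.IsPoisson) (k : ℤ) (z : canCycles Λ (k + 1)) :
    connecting hΛ k (canClass Λ (k + 1) z) = canClass Λ (k - 1)
      ⟨iForms Λ (signForms z), hΛ.iForms_mem_canCycles (signForms_mem_canCycles z.2)⟩ := rfl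

theorem connecting_canClass_eq_smul (hΛ : Λ.IsPoisson) (k : ℤ) (z : canCycles Λ (k + 1)) :
    connecting hΛ k (canClass Λ (k + 1) z) = (-1 : ℝ) ^ (k + 1) •
      canClass Λ (k - 1) ⟨iForms Λ z, hΛ.iForms_mem_canCycles z.2⟩ := by
  rw [connecting_canClass, ← map_smul]
  refine congrArg _ (Subtype.ext ?_)
  change iForms Λ (signForms z) = (-1 : ℝ) ^ (k + 1) • iForms Λ z
  rw [signForms_of_mem z.2.1, map_smul]

/-- The connecting homomorphism is computed by lifting a cycle `z` to a pair `x` and applying `δ`. -/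
theorem connecting_canClass_of_lift (hΛ : Λ.IsPoisson) {k : ℤ} (z : canCycles Λ (k + 1))
    {x : Forms n M × Forms n M} (hx : x ∈ pairsOfDegree n M (k + 1)) (w : canCycles Λ (k - 1))
    (hz : x.1 = z) (hw : ljBoundary Λ x = (0, (w : Forms n M))) :
    connecting hΛ k (canClass Λ (k + 1) z) = canClass Λ (k - 1) w := by
  obtain ⟨α, β⟩ := x
  obtain rfl : α = z := hz
  have h : canBoundary Λ β + iForms Λ (signForms z) = w := congrArg Prod.snd hw
  have hβ : β ∈ formsOfDegree n M (k + 1 - 1) := hx.2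
  rw [show k + 1 - 1 = k - 1 + 1 by ring] at hβ
  rw [connecting_canClass, homologyClass_eq_iff]
  -- The lift `(z, 0)` gives `i s z` and the lift `(z, β)` gives `δ̄ β + i s z`, so the two differ
  -- by the boundary of `-β`.
  refine ⟨-β, Submodule.neg_mem _ hβ, ?_⟩
  rw [map_neg, ← h]
  abel

/-- If the first component of a cycle is `δ̄ γ`, subtracting `δ(γ, 0)` leaves a homologous cycle
with first component zero. -/
theorem exact_inrHomology_fstHomology (hΛ : Λ.IsPoisson) (k : ℤ) :
    Function.Exact (inrHomology Λ k) (fstHomology Λ k) := by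
  intro y
  obtain ⟨⟨⟨α, β⟩, hw⟩, rfl⟩ := homologyClass_surjective y
  constructor
  · intro h
    rw [fstHomology_ljClass, homologyClass_eq_zero_iff] at h
    obtain ⟨γ, hγ, rfl⟩ := h
    have hiγ := iForms_mem (Λ := Λ) (signForms_mem hγ)
    rw [show k + 1 - 2 = k - 1 by ring] at hiγ
    have hsub : ((canBoundary Λ γ, β) : Forms n M × Forms n M) - ljBoundary Λ (γ, 0) =
        (0, β - iForms Λ (signForms γ)) := by
      rw [ljBoundary_zero_right, Prod.mk_sub_mk, sub_self]
    have hcycle : β - iForms Λ (signForms γ) ∈ canCycles Λ (k - 1) := by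
      refine ⟨Submodule.sub_mem _ hw.1.2 hiγ, ?_⟩
      -- Applying `δ` kills the cycle and, by `δ² = 0`, the subtracted boundary, so the remaining
      -- second component is closed.
      have h := congrArg (ljBoundary Λ) hsub
      rw [map_sub, LinearMap.mem_ker.1 hw.2, hΛ.ljBoundary_ljBoundary, ljBoundary_zero_left] at h
      exact (congrArg Prod.snd h).symm.trans (sub_zero _)
    refine ⟨canClass Λ (k - 1) ⟨_, hcycle⟩, ?_⟩
    rw [inrHomology_canClass, homologyClass_eq_iff]
    refine ⟨(-γ, 0), ⟨Submodule.neg_mem _ hγ, Submodule.zero_mem _⟩, ?_⟩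
    change _ = ((0, β - iForms Λ (signForms γ)) : Forms n M × Forms n M) - (canBoundary Λ γ, β)
    rw [← hsub, ljBoundary_zero_right, ljBoundary_zero_right]
    simp
  · rintro ⟨z, hz⟩
    obtain ⟨z, rfl⟩ := homologyClass_surjective z
    rw [← hz, inrHomology_canClass, fstHomology_ljClass, homologyClass_eq_zero_iff]
    exact Submodule.zero_mem _

theorem exact_fstHomology_connecting (hΛ : Λ.IsPoisson) (k : ℤ) :
    Function.Exact (fstHomology Λ (k + 1)) (connecting hΛ k) := by
  intro y
  obtain ⟨z, rfl⟩ := homologyClass_surjective y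
  constructor
  · intro h
    rw [connecting_canClass, homologyClass_eq_zero_iff] at h
    obtain ⟨β, hβ, h⟩ := h
    rw [show k - 1 + 1 = k + 1 - 1 by ring] at hβ
    -- Since `δ̄ β = i s z`, the second component `-β` cancels the cross term of `δ`.
    refine ⟨ljClass Λ (k + 1) ⟨(z, -β), ⟨z.2.1, Submodule.neg_mem _ hβ⟩, ?_⟩, rfl⟩
    rw [SetLike.mem_coe, LinearMap.mem_ker, ljBoundary_apply, LinearMap.mem_ker.1 z.2.2, map_neg, h,
      neg_add_cancel]
    rfl
  · rintro ⟨w, hw⟩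
    obtain ⟨w, rfl⟩ := homologyClass_surjective w
    rw [← hw, fstHomology_ljClass, ← map_zero (canClass Λ (k - 1))]
    -- The cycle `w` is itself a lift of its first component, and `δ w = 0` is the image of the zero
    -- cycle.
    exact connecting_canClass_of_lift hΛ _ w.2.1 0 rfl (LinearMap.mem_ker.1 w.2.2)

theorem exact_connecting_inrHomology (hΛ : Λ.IsPoisson) (k : ℤ) :
    Function.Exact (connecting hΛ k) (inrHomology Λ k) := by
  intro y
  obtain ⟨w, rfl⟩ := homologyClass_surjective y
  constructor
  · intro h
    rw [inrHomology_canClass, homologyClass_eq_zero_iff] at h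
    obtain ⟨x, hx, h⟩ := h
    -- If `δ x = (0, w)`, then `x.1` is a cycle with lift `x`, so the connecting map sends its class
    -- to that of `w`.
    exact ⟨canClass Λ (k + 1) ⟨x.1, hx.1, congrArg Prod.fst h⟩,
      connecting_canClass_of_lift hΛ _ hx w rfl h⟩
  · rintro ⟨z, hz⟩
    obtain ⟨z, rfl⟩ := homologyClass_surjective z
    rw [← hz, connecting_canClass, inrHomology_canClass, homologyClass_eq_zero_iff]
    -- For a cycle `z`, `δ(z, 0) = (0, i s z)` exhibits the image as a boundary.
    refine ⟨(z, 0), ⟨z.2.1, Submodule.zero_mem _⟩, ?_⟩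
    rw [ljBoundary_zero_right, LinearMap.mem_ker.1 z.2.2]

end LongExactSequence

end PoissonHomology
end

theorem theorem4p8 {n : ℕ} {M : Type*} [TopologicalSpace M]
    [ChartedSpace (EuclideanSpace ℝ (Fin n)) M] [IsManifold (𝓡 n) ∞ M]
    (Λ : Bivector n M) (hΛ : Λ.IsPoisson) :
    -- `(Ω^*(M), δ̄)` (hence also its shift `(Ω^{*-1}(M), δ̄)`) and `(Ω^*(M) ⊕ Ω^{*-1}(M), δ)`
    -- are complexes
    IsComplex (formsOfDegree n M) (canBoundary Λ) ∧
    IsComplex (pairsOfDegree n M) (ljBoundary Λ) ∧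
    -- `(0, Id)` is a morphism of complexes `Ω^{*-1}(M) → Ω^*(M) ⊕ Ω^{*-1}(M)`
    (∀ k : ℤ, ∀ β ∈ formsOfDegree n M (k - 1), zeroId n M β ∈ pairsOfDegree n M k ∧
      ljBoundary Λ (zeroId n M β) = zeroId n M (canBoundary Λ β)) ∧
    -- `π₁` is a morphism of complexes `Ω^*(M) ⊕ Ω^{*-1}(M) → Ω^*(M)`
    (∀ k : ℤ, ∀ x ∈ pairsOfDegree n M k, pr₁ n M x ∈ formsOfDegree n M k ∧
      canBoundary Λ (pr₁ n M x) = pr₁ n M (ljBoundary Λ x)) ∧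
    -- the short sequence is exact in each degree
    (∀ k : ℤ, ∀ β ∈ formsOfDegree n M (k - 1), zeroId n M β = 0 → β = 0) ∧
    (∀ k : ℤ, ∀ x ∈ pairsOfDegree n M k,
      pr₁ n M x = 0 ↔ ∃ β ∈ formsOfDegree n M (k - 1), zeroId n M β = x) ∧
    (∀ k : ℤ, ∀ α ∈ formsOfDegree n M k, ∃ x ∈ pairsOfDegree n M k, pr₁ n M x = α) ∧
    -- the long exact sequence; `conn k` is the connecting homomorphism `Λ_{k+1}`
    ∃ (ι : ∀ k : ℤ, HCan Λ (k - 1) →ₗ[ℝ] HLJ Λ k) (π : ∀ k : ℤ, HLJ Λ k →ₗ[ℝ] HCan Λ k)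
      (conn : ∀ k : ℤ, HCan Λ (k + 1) →ₗ[ℝ] HCan Λ (k - 1)),
      -- `ι` is induced by `(0, Id)`
      (∀ (k : ℤ) (z : canCycles Λ (k - 1)), ∃ w : ljCycles Λ k,
        (w : Forms n M × Forms n M) = zeroId n M z ∧
          ι k (canClass Λ (k - 1) z) = ljClass Λ k w) ∧
      -- `π` is induced by `π₁`
      (∀ (k : ℤ) (w : ljCycles Λ k), ∃ z : canCycles Λ k,
        (z : Forms n M) = pr₁ n M w ∧ π k (ljClass Λ k w) = canClass Λ k z) ∧
      -- `conn` is the connecting homomorphism of the short exact sequence: if `x` lifts the cycle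
      -- `z` and `δ x` is the image of the cycle `w`, then `[z]` is sent to `[w]`
      (∀ (k : ℤ) (z : canCycles Λ (k + 1)), ∀ x ∈ pairsOfDegree n M (k + 1),
        ∀ w : canCycles Λ (k - 1), pr₁ n M x = z → ljBoundary Λ x = zeroId n M w →
          conn k (canClass Λ (k + 1) z) = canClass Λ (k - 1) w) ∧
      -- it is given by `Λ_{k+1} [z] = (-1)^{k+1} [i(Λ) z]`
      (∀ (k : ℤ) (z : canCycles Λ (k + 1)), ∃ w : canCycles Λ (k - 1),
        (w : Forms n M) = iForms Λ z ∧
          conn k (canClass Λ (k + 1) z) = (-1 : ℝ) ^ (k + 1) • canClass Λ (k - 1) w) ∧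
      -- exactness at `H_k^{LJ}`, at `H_{k+1}^{can}` and at `H_{k-1}^{can}`
      ∀ k : ℤ, Function.Exact (ι k) (π k) ∧ Function.Exact (π (k + 1)) (conn k) ∧
        Function.Exact (conn k) (ι k) := by
  refine ⟨hΛ.isComplex_canBoundary, hΛ.isComplex_ljBoundary,
    fun k β hβ => ⟨inr_mem_pairsOfDegree hβ, ljBoundary_zero_left β⟩,
    fun k x hx => ⟨hx.1, rfl⟩, fun k β _ h => congrArg Prod.snd h, fun k x hx => ⟨fun h => ?_, ?_⟩,
    fun k α hα => ⟨(α, 0), ⟨hα, Submodule.zero_mem _⟩, rfl⟩,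
    inrHomology Λ, fstHomology Λ, connecting hΛ,
    -- The representatives `_` are found by unification with the explicit cycles in the computing
    -- lemmas.
    fun k z => ⟨_, rfl, inrHomology_canClass k z⟩,
    fun k w => ⟨_, rfl, fstHomology_ljClass k w⟩,
    fun k z x hx w hz hw => connecting_canClass_of_lift hΛ z hx w hz hw,
    fun k z => ⟨_, rfl, connecting_canClass_eq_smul hΛ k z⟩,
    fun k => ⟨exact_inrHomology_fstHomology hΛ k, exact_fstHomology_connecting hΛ k,
      exact_connecting_inrHomology hΛ k⟩⟩
  · exact ⟨x.2, hx.2, Prod.ext h.symm rfl⟩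
  · rintro ⟨β, _, rfl⟩
    rfl
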